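/- Conventions. All graphs are finite and simple. $S_g$ denotes the closed orientable surface of genus $g$. A graph $G$ is biembeddable in $S_g$ if its edge set splits into two edge-disjoint spanning subgraphs, each of which embeds in $S_g$ (not necessarily cellularly). The bigenus $\beta(G)$ is the smallest $g$ such that $G$ is biembeddable in $S_g$, and the bichromatic number $\chi_2(S_g)$ is the largest chromatic number of a graph that is biembeddable in $S_g$. A connected graph triangulates $S_g$ if it has a cellular embedding in $S_g$ all of whose faces are triangles. Embeddings are described combinatorially by rotation systems. **Theorem.** Let $s \ge 0$ be an integer, and put $n = 24s+21$ and $g = 24s^2+29s+8$. Then: 1. The complete graph $K_n$ has a triangular biembedding in $S_g$: its edge set splits into two edge-disjoint connected spanning subgraphs, each of which triangulates $S_g$. 2. Consequently $\beta(K_n) = g = \left\lceil \frac{n^2-13n+24}{24} \right\rceil$, so the Cabaniss–Jackson lower bound $\beta(K_n)\ge\left\lceil \frac{n^2-13n+24}{24} \right\rceil$ is attained. 3. Consequently $\chi_2(S_g) = n = \left\lfloor \frac{13+\sqrt{73+96g}}{2} \right\rfloor$, which solves the generalized Earth–Moon problem for the surface $S_g$. -/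

import Mathlib

/-- A rotation system on a simple graph `G`: a permutation of the arcs of `G` that cyclically
permutes, for every vertex `v`, the arcs leaving `v`. By the Heffter-Edmonds principle, these are
the cellular embeddings of a connected `G` in oriented surfaces (of the connected components of
`G`, each in an oriented surface of its own, in general). -/
structure RotationSystem {V : Type} (G : SimpleGraph V) where
  /-- the arc that follows a given arc in the rotation at its initial vertex -/
  rot : Equiv.Perm G.Dart
  rot_fst : ∀ d : G.Dart, (rot d).fst = d.fst
  rot_sameCycle : ∀ d e : G.Dart, d.fst = e.fst → rot.SameCycle d e

namespace RotationSystem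

variable {V : Type} {G : SimpleGraph V}

/-- Face tracing: the arc `(u, v)` is followed on its face-boundary walk by the arc that follows
`(v, u)` in the rotation at `v`. -/
def facePerm (R : RotationSystem G) : Equiv.Perm G.Dart :=
  (SimpleGraph.Dart.symm_involutive (G := G)).toPerm.trans R.rot

/-- The number of faces: one for each face-boundary walk, that is, for each cycle of `facePerm`,
and one for each isolated vertex (which is embedded in a sphere, with a single face whose boundary
contains no arc). -/
noncomputable def numFaces (R : RotationSystem G) : ℕ :=
  Nat.card (Quotient (Equiv.Perm.SameCycle.setoid R.facePerm)) +
    Nat.card {v : V // ∀ w, ¬ G.Adj v w}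

/-- The Euler polyhedral equation, `|V| - |E| + |F| = 2 - 2 g` for a connected graph. In general
it is summed over the `c` connected components, which gives `|V| - |E| + |F| = 2 c - 2 g`, where `g`
is the sum of the genera of the surfaces that carry the components. -/
def HasGenus (R : RotationSystem G) (g : ℕ) : Prop :=
  (Nat.card V : ℤ) - Nat.card G.edgeSet + R.numFaces = 2 * Nat.card G.ConnectedComponent - 2 * g

/-- Every face is a triangle: every face-boundary walk has length 3, and no face comes from an
isolated vertex. -/
def IsTriangular (R : RotationSystem G) : Prop :=
  (∀ v, ∃ w, G.Adj v w) ∧ ∀ d : G.Dart, Function.minimalPeriod R.facePerm d = 3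

end RotationSystem

/-- `G` triangulates the orientable surface of genus `g`: it is connected and has a cellular
embedding in that surface all of whose faces are triangles. -/
def Triangulates {V : Type} (G : SimpleGraph V) (g : ℕ) : Prop :=
  G.Connected ∧ ∃ R : RotationSystem G, R.IsTriangular ∧ R.HasGenus g

/-- The finite graph `G` embeds, not necessarily cellularly, in the orientable surface of genus
`g`: its components have cellular embeddings in orientable surfaces whose genera add up to at most
`g` (the connected sum of these surfaces, with handles added, is the surface of genus `g`). -/
def EmbedsIn {V : Type} (G : SimpleGraph V) (g : ℕ) : Prop :=
  ∃ R : RotationSystem G, ∃ h ≤ g, R.HasGenus h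

/-- `G` decomposes into the edge-disjoint spanning subgraphs `A` and `B`. -/
def DecomposesInto {V : Type} (G A B : SimpleGraph V) : Prop :=
  A ⊔ B = G ∧ Disjoint A.edgeSet B.edgeSet

/-- `G` is biembeddable in the orientable surface of genus `g`. -/
def Biembeddable {V : Type} (G : SimpleGraph V) (g : ℕ) : Prop :=
  ∃ A B : SimpleGraph V, DecomposesInto G A B ∧ EmbedsIn A g ∧ EmbedsIn B g

/-- `G` has a triangular biembedding in the orientable surface of genus `g`. -/
def HasTriangularBiembedding {V : Type} (G : SimpleGraph V) (g : ℕ) : Prop :=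
  ∃ A B : SimpleGraph V, DecomposesInto G A B ∧ Triangulates A g ∧ Triangulates B g

/-- The bigenus `β(G)`: the least `g` such that the finite graph `G` is biembeddable in the
orientable surface of genus `g`. -/
noncomputable def bigenus {V : Type} (G : SimpleGraph V) : ℕ :=
  sInf {g : ℕ | Biembeddable G g}

/-- The bichromatic number `χ₂(S_g)`: the largest chromatic number of a finite graph that is
biembeddable in the orientable surface of genus `g`. -/
noncomputable def bichromaticNumber (g : ℕ) : ℕ :=
  sSup {k : ℕ | ∃ (m : ℕ) (G : SimpleGraph (Fin m)), Biembeddable G g ∧ G.chromaticNumber = k}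

open SimpleGraph

/-! ### Permutations -/

/-! The lower bounds come from Euler's formula. The `defect` of a rotation system is twice its
genus. Deleting an edge never raises it: for an edge that is not a bridge at most one face is lost,
while deleting a bridge adds both a component and a face. So genus is monotone under subgraphs.
Since all faces have length at least three, except those of single-edge components, a graph of genus
at most `g` that touches at most `w ≥ 3` vertices has at most `3w - 6 + 6g` edges, and a subgraph of
a biembeddable graph at most `6w - 12 + 12g`. For `K_n` this is the bound on the bigenus, and `24 g
= n ^ 2 - 13 n + 24` holds exactly when `n = 24s + 21`, `g = 24s ^ 2 + 29s + 8`. With these values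
every subgraph on more than `n` vertices has average degree below `n`, so greedy colouring needs
only `n` colours.

What remains is a triangular biembedding of `K_n`. Write `n = 3M` and take `ZMod 3 × ZMod M` as
vertex set, with all triangles given up to translation in `ZMod M`. An arc is then a class in `ZMod
3` with a nonzero difference, and there are `3 (3M - 1)` of these. Each graph consists of `(3M - 1)
/ 2` orbits of oriented triangles. If all arcs are covered, then by counting each is covered once;
hence the triangles fit together and the two graphs are edge-disjoint. It also has to be checked
that arcs occur together with their reverses, that every rotation is one cycle, and that both graphs
are connected (`hasTriangularBiembedding_of_triangleFamily`).

For `M = 8t + 15` most triangles lie in a ladder with `2t` rungs, of the same form at all three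
classes; 22 further triangle orbits are listed with entries linear in `t`. Within a rotation the
ladder contributes only runs from one of its ends to the other. Contracting these runs leaves a
cyclic sequence of linear forms that does not depend on `t`, so one finite computation
(`LadderData.Valid`) settles all `t`. The zigzags and rungs sweep out intervals of differences,
which together with the listed triangles exhaust all differences. The case `M = 7` has no ladder and
is checked outright. -/

/-- The permutation obtained from `σ` by cutting `a` out of its cycle. -/
def cutOut {α : Type*} [DecidableEq α] (σ : Equiv.Perm α) (a : α) : Equiv.Perm α :=
  Equiv.swap a (σ a) * σ

section CutOut

variable {α : Type*} [DecidableEq α] (σ : Equiv.Perm α) (a : α)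

theorem cutOut_self : cutOut σ a a = a := by simp [cutOut]

theorem cutOut_of_apply_eq {x : α} (h : σ x = a) : cutOut σ a x = σ a := by
  simp [cutOut, h]

theorem cutOut_of_apply_ne {x : α} (hx : x ≠ a) (h : σ x ≠ a) : cutOut σ a x = σ x := by
  simp only [cutOut, Equiv.Perm.mul_apply]
  exact Equiv.swap_apply_of_ne_of_ne h fun h' => hx (σ.injective h')

/-- Invariance under a single step extends to all powers. In this form invariants pass from darts to
faces. -/
theorem Equiv.Perm.SameCycle.of_forall_apply {β : Type*} {τ : Equiv.Perm β} {r : β → β → Prop}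
    (hr : Equivalence r) (h : ∀ x, r x (τ x)) {x y : β} (hxy : τ.SameCycle x y) : r x y := by
  obtain ⟨n, rfl⟩ := hxy
  have key : ∀ (n : ℕ) (z : β), r z ((τ ^ n) z) := by
    intro n
    induction n with
    | zero => intro z; exact hr.refl _
    | succ k ih => intro z; rw [pow_succ', Equiv.Perm.mul_apply]; exact hr.trans (ih z) (h _)
  obtain ⟨m, rfl | rfl⟩ := n.eq_nat_or_neg
  · simpa using key m x
  · have := key m ((τ ^ (-(m : ℤ))) x)
    rw [← Equiv.Perm.mul_apply, ← zpow_natCast, ← zpow_add] at this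
    simpa using hr.symm this

theorem Equiv.Perm.SameCycle.of_semiconj {β γ : Type*} {σ : Equiv.Perm γ} {τ : Equiv.Perm β}
    {ι : β → γ} (hι : Function.Injective ι) (h : ∀ x, ι (τ x) = σ (ι x)) {x y : β}
    (hxy : σ.SameCycle (ι x) (ι y)) : τ.SameCycle x y := by
  obtain ⟨n, hn⟩ := hxy
  have key : ∀ (n : ℕ) (z : β), (σ ^ n) (ι z) = ι ((τ ^ n) z) := by
    intro n
    induction n with
    | zero => intro z; rfl
    | succ k ih => intro z; rw [pow_succ', pow_succ', Equiv.Perm.mul_apply, Equiv.Perm.mul_apply,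
        ih, h]
  obtain ⟨m, rfl | rfl⟩ := n.eq_nat_or_neg
  · rw [zpow_natCast, key] at hn
    exact ⟨m, hι hn⟩
  · rw [zpow_neg, Equiv.Perm.inv_eq_iff_eq, zpow_natCast, key] at hn
    refine ⟨-(m : ℤ), ?_⟩
    rw [zpow_neg, Equiv.Perm.inv_eq_iff_eq, zpow_natCast]
    exact hι hn

theorem Equiv.Perm.SameCycle.cutOut {σ : Equiv.Perm α} {a x y : α} (h : σ.SameCycle x y)
    (hx : x ≠ a) (hy : y ≠ a) : (cutOut σ a).SameCycle x y := by
  -- `g` moves the removed point to its successor, so that each step of `σ` becomes a step of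
  -- `cutOut σ a` or no step at all.
  set g : α → α := fun z => if z = a then σ a else z with hg
  have hr : Equivalence fun z w => (_root_.cutOut σ a).SameCycle (g z) (g w) :=
    ⟨fun _ => .refl _ _, fun h => h.symm, fun h h' => h.trans h'⟩
  have := Equiv.Perm.SameCycle.of_forall_apply hr (fun z => ?_) h
  · simpa [hg, hx, hy] using this
  · by_cases hz : z = a
    · subst hz
      have : g (σ z) = σ z := by simp only [hg]; split_ifs with h1 <;> simp [h1]
      simp only [this]
      simp only [hg, if_true]
      exact .refl _ _
    · by_cases hz' : σ z = a
      · have h1 := cutOut_of_apply_eq σ a hz'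
        simp only [hg, hz, hz', if_true, if_false, ← h1]
        exact (Equiv.Perm.sameCycle_apply_right).2 (.refl _ _)
      · have h1 := cutOut_of_apply_ne σ a hz hz'
        simp only [hg, hz, hz', if_false]
        rw [← h1]
        exact (Equiv.Perm.sameCycle_apply_right).2 (.refl _ _)

end CutOut

/-! ### Deleting an edge of a rotation system -/

namespace RotationSystem

variable {V : Type} {G : SimpleGraph V}

theorem facePerm_apply (R : RotationSystem G) (d : G.Dart) : R.facePerm d = R.rot d.symm := rfl

theorem facePerm_fst (R : RotationSystem G) (d : G.Dart) : (R.facePerm d).fst = d.snd := by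
  rw [facePerm_apply, R.rot_fst]; rfl

/-- Twice the genus, by the Euler polyhedral equation. -/
noncomputable def defect (R : RotationSystem G) : ℤ :=
  2 * Nat.card G.ConnectedComponent - Nat.card V + Nat.card G.edgeSet - R.numFaces

theorem hasGenus_iff (R : RotationSystem G) (g : ℕ) : R.HasGenus g ↔ R.defect = 2 * g := by
  unfold HasGenus defect; constructor <;> intro h <;> linarith

end RotationSystem

section Delete

variable {V : Type} {G : SimpleGraph V}

theorem SimpleGraph.Dart.symm_ne_self (d : G.Dart) : d.symm ≠ d := SimpleGraph.Dart.symm_ne d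

/-- The darts of a subgraph are darts of the graph. -/
def dartInclusion {H G : SimpleGraph V} (h : H ≤ G) (x : H.Dart) : G.Dart := ⟨x.toProd, h x.adj⟩

theorem dartInclusion_injective {H : SimpleGraph V} (h : H ≤ G) :
    Function.Injective (dartInclusion h) := by
  intro x y hxy
  apply SimpleGraph.Dart.ext
  exact congrArg (fun d : G.Dart => d.toProd) hxy

theorem exists_dartInclusion_eq (d x : G.Dart) (h1 : x ≠ d) (h2 : x ≠ d.symm) :
    ∃ y, dartInclusion (G.deleteEdges_le {d.edge}) y = x := by
  refine ⟨⟨x.toProd, ?_⟩, rfl⟩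
  rw [SimpleGraph.deleteEdges_adj]
  refine ⟨x.adj, ?_⟩
  have : x.edge ≠ d.edge := by
    rw [Ne, SimpleGraph.dart_edge_eq_iff]; tauto
  exact this

theorem dartInclusion_ne (d : G.Dart) (y : (G.deleteEdges {d.edge}).Dart) :
    dartInclusion (G.deleteEdges_le {d.edge}) y ≠ d ∧
      dartInclusion (G.deleteEdges_le {d.edge}) y ≠ d.symm := by
  have h := y.adj
  rw [SimpleGraph.deleteEdges_adj] at h
  have h' : (dartInclusion (G.deleteEdges_le {d.edge}) y).edge ≠ d.edge := h.2
  rw [Ne, SimpleGraph.dart_edge_eq_iff] at h'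
  tauto

open scoped Classical

namespace RotationSystem

/-- The rotation on all the darts in which `d` and its reverse have been cut out. -/
noncomputable def rotCut (R : RotationSystem G) (d : G.Dart) : Equiv.Perm G.Dart :=
  cutOut (cutOut R.rot d) d.symm

variable (R : RotationSystem G) (d : G.Dart)

theorem fst_symm_ne (d : G.Dart) : d.symm.fst ≠ d.fst := d.adj.ne'

theorem rotCut_apply {x : G.Dart} (h1 : x ≠ d) (h2 : x ≠ d.symm) :
    R.rotCut d x = if R.rot x = d then R.rot d
      else if R.rot x = d.symm then R.rot d.symm else R.rot x := by
  have e1 : R.rot d ≠ d.symm := fun h => fst_symm_ne d (by rw [← h, R.rot_fst])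
  have e2 : R.rot d.symm ≠ d := fun h => fst_symm_ne d (by rw [← R.rot_fst d.symm, h])
  have e3 : cutOut R.rot d d.symm = R.rot d.symm :=
    cutOut_of_apply_ne _ _ d.symm_ne_self e2
  unfold rotCut
  split_ifs with h h'
  · rw [cutOut_of_apply_ne _ _ h2] <;> rw [cutOut_of_apply_eq _ _ h]
    exact e1
  · rw [cutOut_of_apply_eq _ _ (by rw [cutOut_of_apply_ne _ _ h1 h, h']), e3]
  · rw [cutOut_of_apply_ne _ _ h2] <;> rw [cutOut_of_apply_ne _ _ h1 h]
    exact h'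

theorem rotCut_fst {x : G.Dart} (h1 : x ≠ d) (h2 : x ≠ d.symm) :
    (R.rotCut d x).fst = x.fst := by
  have hx := R.rot_fst x
  rw [R.rotCut_apply d h1 h2]
  split_ifs with h h'
  · rw [R.rot_fst, ← h, hx]
  · rw [R.rot_fst, ← h', hx]
  · exact hx

theorem rotCut_self : R.rotCut d d = d := by
  have e1 : cutOut R.rot d d = d := cutOut_self _ _
  unfold rotCut
  rw [cutOut_of_apply_ne _ _ d.symm_ne_self.symm] <;> rw [e1]
  exact d.symm_ne_self.symm

theorem rotCut_symm : R.rotCut d d.symm = d.symm := cutOut_self _ _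

theorem rotCut_mem_iff (x : G.Dart) :
    (R.rotCut d x ≠ d ∧ R.rotCut d x ≠ d.symm) ↔ (x ≠ d ∧ x ≠ d.symm) := by
  have a := (R.rotCut d).injective.ne_iff (x := x) (y := d)
  have b := (R.rotCut d).injective.ne_iff (x := x) (y := d.symm)
  rw [rotCut_self] at a
  rw [rotCut_symm] at b
  rw [a, b]

/-- The darts that are left after the deletion of an edge. -/
noncomputable def dartEquiv (d : G.Dart) :
    (G.deleteEdges {d.edge}).Dart ≃ {x : G.Dart // x ≠ d ∧ x ≠ d.symm} :=
  Equiv.ofBijective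
    (fun y => ⟨dartInclusion (G.deleteEdges_le {d.edge}) y, dartInclusion_ne d y⟩)
    ⟨fun _ _ h => dartInclusion_injective (G.deleteEdges_le {d.edge}) (congrArg Subtype.val h),
      fun ⟨x, hx⟩ => by
        obtain ⟨y, hy⟩ := exists_dartInclusion_eq d x hx.1 hx.2
        exact ⟨y, Subtype.ext hy⟩⟩

theorem dartEquiv_apply (d : G.Dart) (y : (G.deleteEdges {d.edge}).Dart) :
    (dartEquiv d y : G.Dart) = dartInclusion (G.deleteEdges_le {d.edge}) y := rfl

/-- The rotation induced on the darts that are left after the deletion of an edge. -/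
noncomputable def rotDelete : Equiv.Perm (G.deleteEdges {d.edge}).Dart :=
  (dartEquiv d).symm.permCongr ((R.rotCut d).subtypePerm (R.rotCut_mem_iff d))

theorem dartInclusion_rotDelete (y : (G.deleteEdges {d.edge}).Dart) :
    dartInclusion (G.deleteEdges_le {d.edge}) (R.rotDelete d y) =
      R.rotCut d (dartInclusion (G.deleteEdges_le {d.edge}) y) := by
  rw [← dartEquiv_apply, ← dartEquiv_apply]
  simp [rotDelete, Equiv.permCongr_apply]

/-- The rotation system induced on the graph with an edge deleted. -/
noncomputable def deleteEdge : RotationSystem (G.deleteEdges {d.edge}) where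
  rot := R.rotDelete d
  rot_fst y := by
    have h2 := R.rotCut_fst d (dartInclusion_ne d y).1 (dartInclusion_ne d y).2
    rw [← dartInclusion_rotDelete] at h2
    exact h2
  rot_sameCycle y z hyz := by
    obtain ⟨y1, y2⟩ := dartInclusion_ne d y
    obtain ⟨z1, z2⟩ := dartInclusion_ne d z
    refine Equiv.Perm.SameCycle.of_semiconj (dartInclusion_injective (G.deleteEdges_le {d.edge}))
      (R.dartInclusion_rotDelete d) ?_
    exact ((R.rot_sameCycle (dartInclusion (G.deleteEdges_le {d.edge}) y)
      (dartInclusion (G.deleteEdges_le {d.edge}) z) hyz).cutOut y1 z1).cutOut y2 z2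

theorem dartInclusion_facePerm_deleteEdge (y : (G.deleteEdges {d.edge}).Dart) :
    dartInclusion (G.deleteEdges_le {d.edge}) ((R.deleteEdge d).facePerm y) =
      let x := dartInclusion (G.deleteEdges_le {d.edge}) y
      if R.facePerm x = d then R.facePerm d.symm
        else if R.facePerm x = d.symm then R.facePerm d else R.facePerm x := by
  have h := R.dartInclusion_rotDelete d y.symm
  obtain ⟨y1, y2⟩ := dartInclusion_ne d y.symm
  rw [R.rotCut_apply d y1 y2] at h
  simp only [facePerm_apply, SimpleGraph.Dart.symm_symm]
  exact h

end RotationSystem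
end Delete

/-! ### Faces under the deletion of an edge -/

namespace RotationSystem

variable {V : Type} {G : SimpleGraph V} (R : RotationSystem G)

/-- The face-boundary walks of a rotation system. -/
abbrev Face : Type := Quotient (Equiv.Perm.SameCycle.setoid R.facePerm)

/-- The face-boundary walk through a dart. -/
def face (d : G.Dart) : R.Face := Quotient.mk _ d

theorem face_eq_iff {d e : G.Dart} : R.face d = R.face e ↔ R.facePerm.SameCycle d e :=
  Quotient.eq (r := Equiv.Perm.SameCycle.setoid R.facePerm)

theorem face_facePerm (d : G.Dart) : R.face (R.facePerm d) = R.face d :=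
  R.face_eq_iff.2 (Equiv.Perm.sameCycle_apply_left.2 (.refl _ _))

theorem facePerm_ne (d : G.Dart) : R.facePerm d ≠ d := fun h =>
  d.adj.ne ((R.facePerm_fst d).symm.trans (by rw [h])).symm

theorem facePerm_symm_eq_rot (d : G.Dart) : R.facePerm d.symm = R.rot d := by
  rw [facePerm_apply, SimpleGraph.Dart.symm_symm]

/-- If the two sides of an edge are on different faces, then the edge is not a bridge. -/
theorem reachable_of_face_ne [Finite V] (d : G.Dart) (h : R.face d ≠ R.face d.symm) :
    (G.deleteEdges {d.edge}).Reachable d.fst d.snd := by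
  by_contra hcon
  -- Follow the face from `d`. If `d` were a bridge, the walk would stay at the side of `d.snd`: it
  -- can cross back neither by `d.symm`, which is on another face, nor by `d`, whose initial vertex
  -- is on the other side. But the walk is periodic and returns to `d`.
  have key : ∀ n : ℕ,
      (G.deleteEdges {d.edge}).Reachable d.snd ((R.facePerm ^ n) d).snd ∧
        R.face ((R.facePerm ^ n) d) = R.face d := by
    intro n
    induction n with
    | zero => exact ⟨.refl _, rfl⟩
    | succ k ih =>
      rw [pow_succ', Equiv.Perm.mul_apply]
      set x := (R.facePerm ^ k) d
      have hf : R.face (R.facePerm x) = R.face d := (R.face_facePerm x).trans ih.2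
      refine ⟨?_, hf⟩
      have hfst := R.facePerm_fst x
      have h1 : R.facePerm x ≠ d := fun he => hcon (by
        rw [he] at hfst; rw [hfst]; exact ih.1.symm)
      have h2 : R.facePerm x ≠ d.symm := fun he => h (by rw [← hf, he])
      obtain ⟨y, hy⟩ := exists_dartInclusion_eq d _ h1 h2
      have hadj := y.adj
      have e1 : y.fst = (R.facePerm x).fst := by rw [← hy]; rfl
      have e2 : y.snd = (R.facePerm x).snd := by rw [← hy]; rfl
      rw [e1, e2, hfst] at hadj
      exact ih.1.trans hadj.reachable
  have : Finite G.Dart := Finite.of_injective _ SimpleGraph.Dart.toProd_injective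
  have hpos : 0 < orderOf R.facePerm := orderOf_pos _
  obtain ⟨k, hk⟩ := Nat.exists_eq_succ_of_ne_zero hpos.ne'
  have h1 := (key k).1
  have h2 : R.facePerm ((R.facePerm ^ k) d) = d := by
    rw [← Equiv.Perm.mul_apply, ← pow_succ', ← Nat.succ_eq_add_one, ← hk, pow_orderOf_eq_one]; rfl
  have h3 := R.facePerm_fst ((R.facePerm ^ k) d)
  rw [h2] at h3
  rw [← h3] at h1
  exact hcon h1.symm

/-- The vertices without neighbours. -/
abbrev _root_.SimpleGraph.Isolated (G : SimpleGraph V) : Type := {v : V // ∀ w, ¬ G.Adj v w}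

section Delete

variable (d : G.Dart)

open scoped Classical in
/-- The face of `R` that contains a given dart, if it does not meet the deleted edge. -/
noncomputable def faceOriginDart (y : (G.deleteEdges {d.edge}).Dart) : Option R.Face :=
  if R.face (dartInclusion (G.deleteEdges_le {d.edge}) y) = R.face d ∨
    R.face (dartInclusion (G.deleteEdges_le {d.edge}) y) = R.face d.symm then none
  else some (R.face (dartInclusion (G.deleteEdges_le {d.edge}) y))

theorem faceOriginDart_facePerm (y : (G.deleteEdges {d.edge}).Dart) :
    R.faceOriginDart d y = R.faceOriginDart d ((R.deleteEdge d).facePerm y) := by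
  have h := R.dartInclusion_facePerm_deleteEdge d y
  unfold faceOriginDart
  simp only at h
  rw [h]
  have hx := R.face_facePerm (dartInclusion (G.deleteEdges_le {d.edge}) y)
  by_cases h1 : R.facePerm (dartInclusion (G.deleteEdges_le {d.edge}) y) = d
  · rw [h1] at hx
    rw [if_pos h1, if_pos (Or.inr (face_facePerm _ _)), if_pos (Or.inl hx.symm)]
  · by_cases h2 : R.facePerm (dartInclusion (G.deleteEdges_le {d.edge}) y) = d.symm
    · rw [h2] at hx
      rw [if_neg h1, if_pos h2, if_pos (Or.inl (face_facePerm _ _)), if_pos (Or.inr hx.symm)]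
    · rw [if_neg h1, if_neg h2, hx]

/-- The face of `R` from which a face of `R.deleteEdge d` comes, if it does not meet the deleted
edge. -/
noncomputable def faceOrigin : (R.deleteEdge d).Face → Option R.Face :=
  Quotient.lift (R.faceOriginDart d) fun _ _ hyz =>
    Equiv.Perm.SameCycle.of_forall_apply (τ := (R.deleteEdge d).facePerm)
      (r := fun y z => R.faceOriginDart d y = R.faceOriginDart d z)
      ⟨fun _ => rfl, fun h => h.symm, fun h h' => h.trans h'⟩ (R.faceOriginDart_facePerm d) hyz

theorem faceOrigin_face (y : (G.deleteEdges {d.edge}).Dart) :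
    R.faceOrigin d ((R.deleteEdge d).face y) = none ↔
      R.face (dartInclusion (G.deleteEdges_le {d.edge}) y) = R.face d ∨
      R.face (dartInclusion (G.deleteEdges_le {d.edge}) y) = R.face d.symm := by
  change R.faceOriginDart d y = none ↔ _
  simp [faceOriginDart, or_iff_not_imp_left]

theorem exists_faceOrigin_eq_some (q : R.Face) (h1 : q ≠ R.face d) (h2 : q ≠ R.face d.symm) :
    ∃ q', R.faceOrigin d q' = some q := by
  obtain ⟨x, rfl⟩ : ∃ x, R.face x = q := Quotient.exists_rep q
  obtain ⟨y, hy⟩ := exists_dartInclusion_eq d x (fun h => h1 (by rw [h])) (fun h => h2 (by rw [h]))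
  refine ⟨(R.deleteEdge d).face y, ?_⟩
  change R.faceOriginDart d y = _
  rw [faceOriginDart, hy]
  exact if_neg (by rintro (h | h); exacts [h1 h, h2 h])

instance [Finite V] : Finite G.Dart := Finite.of_injective _ SimpleGraph.Dart.toProd_injective

/-- The deletion of an edge loses at most one face. -/
theorem numFaces_le_deleteEdge [Finite V] :
    R.numFaces ≤ (R.deleteEdge d).numFaces + 1 := by
  have hiso : Nat.card G.Isolated ≤ Nat.card (G.deleteEdges {d.edge}).Isolated :=
    Nat.card_le_card_of_injective
      (fun v => ⟨v.1, fun w hw => v.2 w (G.deleteEdges_le {d.edge} hw)⟩)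
      fun v w h => Subtype.ext (by simpa using h)
  have hface : Nat.card R.Face ≤ Nat.card (R.deleteEdge d).Face + 1 := by
    -- Faces off the edge survive, so if both sides are on one face, only that face can be lost.
    -- Otherwise the dart after `d` survives and its new face stands in for one of the two merged
    -- faces.
    by_cases hd : R.face d = R.face d.symm
    · have : Function.Surjective fun q' : Option (R.deleteEdge d).Face =>
          (q'.bind (R.faceOrigin d)).getD (R.face d) := by
        intro q
        by_cases hq : q = R.face d
        · exact ⟨none, by simp [hq]⟩
        · obtain ⟨q', h⟩ := R.exists_faceOrigin_eq_some d q hq (hd ▸ hq)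
          exact ⟨some q', by simp [h]⟩
      simpa [Finite.card_option] using Nat.card_le_card_of_surjective _ this
    · have hne : R.facePerm d ≠ d.symm := fun h => hd (by rw [← h, face_facePerm])
      obtain ⟨y, hy⟩ := exists_dartInclusion_eq d _ (R.facePerm_ne d) hne
      have hy' := (R.faceOrigin_face d y).2 (Or.inl (by rw [hy, face_facePerm]))
      have : Function.Surjective fun q' : Option (R.deleteEdge d).Face =>
          q'.elim (R.face d) fun q => (R.faceOrigin d q).getD (R.face d.symm) := by
        intro q
        by_cases hq : q = R.face d
        · exact ⟨none, by simp [hq]⟩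
        by_cases hq2 : q = R.face d.symm
        · exact ⟨some ((R.deleteEdge d).face y), by simp [hy', hq2]⟩
        · obtain ⟨q', h⟩ := R.exists_faceOrigin_eq_some d q hq hq2
          exact ⟨some q', by simp [h]⟩
      simpa [Finite.card_option] using Nat.card_le_card_of_surjective _ this
  unfold numFaces
  change Nat.card R.Face + Nat.card G.Isolated ≤
    Nat.card (R.deleteEdge d).Face + Nat.card (G.deleteEdges {d.edge}).Isolated + 1
  omega

/-- In a face of the graph with an edge deleted, all initial vertices are in one component. -/
theorem reachable_of_face_eq {y z : G.Dart} (h : R.face y = R.face z) :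
    G.Reachable y.fst z.fst := by
  refine Equiv.Perm.SameCycle.of_forall_apply (τ := R.facePerm)
    (r := fun y z : G.Dart => G.Reachable y.fst z.fst)
    ⟨fun _ => .refl _, fun h => h.symm, fun h h' => h.trans h'⟩ ?_ (R.face_eq_iff.1 h)
  intro y
  rw [R.facePerm_fst]
  exact y.adj.reachable

/-- If an edge is deleted then an end of it becomes isolated, or else a face at this end comes from
the deleted edge. -/
theorem isolated_or_exists_faceOrigin_eq_none (e : G.Dart) (he : e = d ∨ e = d.symm) :
    (∀ w, ¬ (G.deleteEdges {d.edge}).Adj e.fst w) ∨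
      ∃ y : (G.deleteEdges {d.edge}).Dart, y.fst = e.fst ∧
        R.faceOrigin d ((R.deleteEdge d).face y) = none := by
  have hne : ∀ y, dartInclusion (G.deleteEdges_le {d.edge}) y ≠ e := fun y => by
    rcases he with rfl | rfl
    exacts [(dartInclusion_ne _ y).1, (dartInclusion_ne _ y).2]
  by_cases h : R.rot e = e
  · left
    intro w hw
    let y : (G.deleteEdges {d.edge}).Dart := ⟨(e.fst, w), hw⟩
    obtain ⟨n, hn⟩ := R.rot_sameCycle e (dartInclusion (G.deleteEdges_le {d.edge}) y) rfl
    have : (R.rot ^ n) e = e := Equiv.Perm.zpow_apply_eq_self_of_apply_eq_self h n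
    exact hne y (hn.symm.trans this)
  · right
    have h2 : R.rot e ≠ e.symm := fun h => fst_symm_ne e (by rw [← h, R.rot_fst])
    obtain ⟨y, hy⟩ := exists_dartInclusion_eq d (R.rot e)
      (by rcases he with rfl | rfl; exacts [h, by simpa using h2])
      (by rcases he with rfl | rfl; exacts [h2, h])
    refine ⟨y, ?_, (R.faceOrigin_face d y).2 ?_⟩
    · have : (dartInclusion (G.deleteEdges_le {d.edge}) y).fst = e.fst := by rw [hy, R.rot_fst]
      exact this
    · rw [hy, ← facePerm_symm_eq_rot, face_facePerm]
      rcases he with rfl | rfl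
      · exact Or.inr rfl
      · exact Or.inl (by rw [SimpleGraph.Dart.symm_symm])

/-- The deletion of a bridge gains a face. -/
theorem numFaces_lt_deleteEdge [Finite V]
    (h : ¬ (G.deleteEdges {d.edge}).Reachable d.fst d.snd) :
    R.numFaces + 1 ≤ (R.deleteEdge d).numFaces := by
  have hd : R.face d = R.face d.symm := by
    by_contra hne
    exact h (R.reachable_of_face_ne d hne)
  set H := G.deleteEdges {d.edge} with hH
  let side : (R.deleteEdge d).Face → Prop := fun q => ∃ y, (R.deleteEdge d).face y = q ∧
    H.Reachable y.fst d.fst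
  classical
  -- A bridge has one face on both sides. The two Booleans stand for what replaces this face: at
  -- each end of the bridge a face, or the face of a vertex that has become isolated. Hence the
  -- gain.
  let X := {q : R.Face // q ≠ R.face d} ⊕ (G.Isolated ⊕ Bool)
  let f : (R.deleteEdge d).Face ⊕ H.Isolated → X := Sum.elim
    (fun q => match R.faceOrigin d q with
      | none => Sum.inr (Sum.inr (decide (side q)))
      | some p => if hp : p = R.face d then Sum.inr (Sum.inr true) else Sum.inl ⟨p, hp⟩)
    (fun v => if h1 : ∀ w, ¬ G.Adj v.1 w then Sum.inr (Sum.inl ⟨v.1, h1⟩)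
      else Sum.inr (Sum.inr (decide (v.1 = d.fst))))
  have hsurj : Function.Surjective f := by
    rintro (⟨q, hq⟩ | v | b)
    · obtain ⟨q', hq'⟩ := R.exists_faceOrigin_eq_some d q hq (hd ▸ hq)
      exact ⟨Sum.inl q', by simp [f, hq', hq]⟩
    · refine ⟨Sum.inr ⟨v.1, fun w hw => v.2 w (G.deleteEdges_le _ hw)⟩, ?_⟩
      have := v.2
      simp only [f, Sum.elim_inr]
      rw [dif_pos this]
    · obtain ⟨e, he, hb⟩ : ∃ e : G.Dart, (e = d ∨ e = d.symm) ∧ (b = decide (e = d)) := by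
        cases b
        · exact ⟨d.symm, Or.inr rfl, by simp [d.symm_ne_self]⟩
        · exact ⟨d, Or.inl rfl, by simp⟩
      have hfst : e.fst = d.fst ↔ e = d := by
        rcases he with rfl | rfl
        · simp
        · simp only [d.symm_ne_self, iff_false]; exact fst_symm_ne d
      rcases R.isolated_or_exists_faceOrigin_eq_none d e he with h1 | ⟨y, hy, hy2⟩
      · refine ⟨Sum.inr ⟨e.fst, h1⟩, ?_⟩
        have : ¬ ∀ w, ¬ G.Adj e.fst w := fun hw => hw _ e.adj
        simp only [f, Sum.elim_inr]
        rw [dif_neg this, hb, decide_eq_decide.2 hfst]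
      · refine ⟨Sum.inl ((R.deleteEdge d).face y), ?_⟩
        simp only [f, Sum.elim_inl, hy2]
        rw [hb]
        congr 3
        rw [eq_iff_iff, ← hfst]
        constructor
        · rintro ⟨z, hz, hz2⟩
          have h3 : H.Reachable e.fst d.fst :=
            (hy ▸ (R.deleteEdge d).reachable_of_face_eq hz.symm).trans hz2
          by_contra hcon
          rcases he with rfl | rfl
          · exact hcon rfl
          · exact h h3.symm
        · intro h3
          exact ⟨y, rfl, by rw [hy, h3]⟩
  have hcard := Nat.card_le_card_of_surjective f hsurj
  rw [Nat.card_sum, Nat.card_sum, Nat.card_sum] at hcard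
  have h1 : Nat.card {q : R.Face // q ≠ R.face d} + 1 = Nat.card R.Face := by
    have := Nat.card_congr (Equiv.sumCompl fun q : R.Face => q = R.face d)
    rw [Nat.card_sum] at this
    simpa [add_comm] using this
  have h2 : Nat.card Bool = 2 := by simp
  unfold numFaces
  change Nat.card R.Face + Nat.card G.Isolated + 1 ≤
    Nat.card (R.deleteEdge d).Face + Nat.card H.Isolated
  omega

end Delete
end RotationSystem

/-! ### Edges and components under the deletion of an edge -/

namespace SimpleGraph

variable {V : Type} {G : SimpleGraph V}

theorem card_edgeSet_deleteEdge [Finite V] (d : G.Dart) :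
    Nat.card (G.deleteEdges {d.edge}).edgeSet + 1 = Nat.card G.edgeSet := by
  rw [SimpleGraph.edgeSet_deleteEdges]
  have := Set.ncard_sdiff_singleton_add_one (s := G.edgeSet) (a := d.edge) d.edge_mem
    (Set.toFinite _)
  exact this

/-- A walk that uses the edge reaches an end of it before the first use and leaves from an end after
the last use. -/
theorem reachable_deleteEdge_or (d : G.Dart) {x y : V} (h : G.Reachable x y) :
    (G.deleteEdges {d.edge}).Reachable x y ∨
      (((G.deleteEdges {d.edge}).Reachable x d.fst ∨ (G.deleteEdges {d.edge}).Reachable x d.snd) ∧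
      ((G.deleteEdges {d.edge}).Reachable y d.fst ∨
        (G.deleteEdges {d.edge}).Reachable y d.snd)) := by
  obtain ⟨w⟩ := h
  induction w with
  | nil => exact Or.inl (.refl _)
  | cons hadj _ ih =>
    rename_i u v z _
    by_cases he : s(u, v) = d.edge
    · have hs : (u = d.fst ∧ v = d.snd) ∨ (u = d.snd ∧ v = d.fst) := by
        have : s(u, v) = s(d.fst, d.snd) := he
        exact Sym2.eq_iff.1 this
      rcases hs with ⟨rfl, rfl⟩ | ⟨rfl, rfl⟩
      · rcases ih with ih | ⟨_, ih⟩
        · exact Or.inr ⟨Or.inl (.refl _), Or.inr ih.symm⟩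
        · exact Or.inr ⟨Or.inl (.refl _), ih⟩
      · rcases ih with ih | ⟨_, ih⟩
        · exact Or.inr ⟨Or.inr (.refl _), Or.inl ih.symm⟩
        · exact Or.inr ⟨Or.inr (.refl _), ih⟩
    · have h1 : (G.deleteEdges {d.edge}).Reachable u v :=
        SimpleGraph.Adj.reachable ((SimpleGraph.deleteEdges_adj).2 ⟨hadj, he⟩)
      rcases ih with ih | ⟨ih1, ih⟩
      · exact Or.inl (h1.trans ih)
      · exact Or.inr ⟨ih1.imp h1.trans h1.trans, ih⟩

theorem card_connectedComponent_deleteEdge_le [Finite V] (d : G.Dart) :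
    Nat.card (G.deleteEdges {d.edge}).ConnectedComponent ≤ Nat.card G.ConnectedComponent + 1 := by
  classical
  -- Only the component of the edge can split, and then into two parts; setting the part of `d.fst`
  -- aside makes the map to the old components injective.
  let f : (G.deleteEdges {d.edge}).ConnectedComponent → Option G.ConnectedComponent := fun c =>
    if c = (G.deleteEdges {d.edge}).connectedComponentMk d.fst then none
    else some (c.map (Hom.ofLE (G.deleteEdges_le _)))
  have hf : Function.Injective f := by
    intro c c' h
    induction c using ConnectedComponent.ind with | _ x
    induction c' using ConnectedComponent.ind with | _ y
    simp only [f, ConnectedComponent.eq, ConnectedComponent.map_mk] at h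
    split_ifs at h with h1 h2 h2
    · exact ConnectedComponent.eq.2 (h1.trans h2.symm)
    · simp only [Option.some.injEq, ConnectedComponent.eq] at h
      rw [ConnectedComponent.eq]
      rcases reachable_deleteEdge_or d h with h3 | ⟨h3, h4⟩
      · exact h3
      · rcases h3 with h3 | h3
        · exact absurd h3 h1
        rcases h4 with h4 | h4
        · exact absurd h4 h2
        exact h3.trans h4.symm
  simpa [Finite.card_option] using Nat.card_le_card_of_injective f hf

theorem card_connectedComponent_deleteEdge_le_of_reachable [Finite V] (d : G.Dart)
    (hd : (G.deleteEdges {d.edge}).Reachable d.fst d.snd) :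
    Nat.card (G.deleteEdges {d.edge}).ConnectedComponent ≤ Nat.card G.ConnectedComponent := by
  refine Nat.card_le_card_of_injective
    (fun c => c.map (Hom.ofLE (G.deleteEdges_le {d.edge}))) fun c c' h => ?_
  induction c using ConnectedComponent.ind with | _ x
  induction c' using ConnectedComponent.ind with | _ y
  simp only [ConnectedComponent.map_mk, ConnectedComponent.eq] at h
  rw [ConnectedComponent.eq]
  rcases reachable_deleteEdge_or d h with h3 | ⟨h3, h4⟩
  · exact h3
  · have h5 : ∀ z, (G.deleteEdges {d.edge}).Reachable z d.fst ∨
        (G.deleteEdges {d.edge}).Reachable z d.snd → (G.deleteEdges {d.edge}).Reachable z d.fst :=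
      fun z hz => hz.elim id fun h => h.trans hd.symm
    exact (h5 _ h3).trans (h5 _ h4).symm

end SimpleGraph

/-! ### Monotonicity of the genus -/

namespace RotationSystem

variable {V : Type} [Finite V] {G : SimpleGraph V}

/-- With `c` components, the defect is `2c - |V| + |E| - |F|`. For a non-bridge `c` does not grow
and the lost edge pays for the lost face; for a bridge the change is at most `2 - 1 - 1 = 0`. -/
theorem defect_deleteEdge_le (R : RotationSystem G) (d : G.Dart) :
    (R.deleteEdge d).defect ≤ R.defect := by
  have h1 := SimpleGraph.card_edgeSet_deleteEdge d
  unfold defect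
  by_cases h : (G.deleteEdges {d.edge}).Reachable d.fst d.snd
  · have h2 := SimpleGraph.card_connectedComponent_deleteEdge_le_of_reachable d h
    have h3 := R.numFaces_le_deleteEdge d
    omega
  · have h2 := SimpleGraph.card_connectedComponent_deleteEdge_le d
    have h3 := R.numFaces_lt_deleteEdge d h
    omega

/-- The genus does not grow if edges are deleted. -/
theorem exists_defect_le_of_le (R : RotationSystem G) {H : SimpleGraph V} (hH : H ≤ G) :
    ∃ R' : RotationSystem H, R'.defect ≤ R.defect := by
  induction hn : Nat.card G.edgeSet using Nat.strong_induction_on generalizing G with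
  | _ n ih =>
    by_cases heq : H = G
    · subst heq
      exact ⟨R, le_rfl⟩
    · obtain ⟨u, v, huv, huv'⟩ : ∃ u v, G.Adj u v ∧ ¬ H.Adj u v := by
        by_contra! hcon
        exact heq (le_antisymm hH fun u v => hcon u v)
      let d : G.Dart := ⟨(u, v), huv⟩
      have h1 := SimpleGraph.card_edgeSet_deleteEdge d
      obtain ⟨R', hR'⟩ := ih (Nat.card (G.deleteEdges {d.edge}).edgeSet) (by omega)
        (R.deleteEdge d) (by
          intro x y hxy
          refine (SimpleGraph.deleteEdges_adj).2 ⟨hH hxy, fun h => huv' ?_⟩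
          have h' : s(x, y) = s(u, v) := h
          rw [← SimpleGraph.mem_edgeSet, ← h']
          exact hxy) rfl
      exact ⟨R', hR'.trans (R.defect_deleteEdge_le d)⟩

end RotationSystem

/-! ### The Euler bound on the number of edges -/

namespace RotationSystem

variable {V : Type} {G : SimpleGraph V} (R : RotationSystem G)

/-- A dart on a face-boundary walk of length two spans a component. -/
theorem reachable_iff_of_facePerm_facePerm {d : G.Dart} (hd : R.facePerm (R.facePerm d) = d)
    {x : V} : G.Reachable d.fst x ↔ x = d.fst ∨ x = d.snd := by
  have h1 : R.facePerm d = d.symm := by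
    have a := R.facePerm_fst d
    have b := R.facePerm_fst (R.facePerm d)
    rw [hd] at b
    exact SimpleGraph.Dart.ext _ _ (Prod.ext a b.symm)
  have h2 : ∀ e : G.Dart, R.rot e = e → ∀ w, G.Adj e.fst w → w = e.snd := by
    intro e he w hw
    obtain ⟨n, hn⟩ := R.rot_sameCycle e ⟨(e.fst, w), hw⟩ rfl
    rw [Equiv.Perm.zpow_apply_eq_self_of_apply_eq_self he n] at hn
    rw [hn]
  have h3 := h2 d (by rw [← facePerm_symm_eq_rot, ← h1, hd])
  have h4 := h2 d.symm (by rw [← facePerm_apply, h1])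
  constructor
  · rintro ⟨w⟩
    suffices ∀ u v (w : G.Walk u v), (u = d.fst ∨ u = d.snd) → (v = d.fst ∨ v = d.snd) from
      this _ _ w (Or.inl rfl)
    intro u v w
    induction w with
    | nil => exact id
    | cons hadj _ ih =>
      rintro (rfl | rfl)
      · exact ih (Or.inr (h3 _ hadj))
      · exact ih (Or.inl (h4 _ hadj))
  · rintro (rfl | rfl)
    · exact .refl _
    · exact d.adj.reachable

theorem eq_of_reachable_of_isolated {u v : V} (hu : ∀ w, ¬ G.Adj u w) (h : G.Reachable u v) :
    u = v := by
  obtain ⟨w⟩ := h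
  cases w with
  | nil => rfl
  | cons h _ => exact absurd h (hu _)

variable [Finite V]

theorem card_dart (G : SimpleGraph V) : Nat.card G.Dart = 2 * Nat.card G.edgeSet := by
  classical
  have := Fintype.ofFinite V
  rw [Nat.card_eq_fintype_card, Nat.card_eq_fintype_card, SimpleGraph.card_edgeSet,
    SimpleGraph.dart_card_eq_twice_card_edges]

/-- The faces whose boundary walk has length two. -/
abbrev Digon : Type := {q : R.Face // ∃ d, R.face d = q ∧ R.facePerm (R.facePerm d) = d}

/-- Count darts by faces: there are no loops, so a face has at least two darts, and at least three
unless it is a digon. -/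
theorem three_mul_card_face_le :
    3 * Nat.card R.Face ≤ 2 * Nat.card G.edgeSet + Nat.card R.Digon := by
  classical
  have := Fintype.ofFinite G.Dart
  have := Fintype.ofFinite R.Face
  rw [← card_dart, Nat.card_eq_fintype_card, Nat.card_eq_fintype_card, Nat.card_eq_fintype_card,
    ← Finset.card_univ, ← Finset.card_univ, Fintype.card_subtype,
    Finset.card_eq_sum_card_fiberwise (f := R.face) (t := Finset.univ) (fun _ _ => by simp),
    Finset.card_filter, ← Finset.sum_add_distrib, mul_comm, ← smul_eq_mul, ← Finset.sum_const]
  refine Finset.sum_le_sum fun q _ => ?_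
  obtain ⟨d, rfl⟩ : ∃ d, R.face d = q := Quotient.exists_rep q
  have h1 := R.face_facePerm d
  have h2 := R.face_facePerm (R.facePerm d)
  split_ifs with hq
  · have : ({d, R.facePerm d} : Finset G.Dart) ⊆
        Finset.univ.filter fun e => R.face e = R.face d := by
      intro e; simp only [Finset.mem_insert, Finset.mem_singleton, Finset.mem_filter,
        Finset.mem_univ, true_and]
      rintro (rfl | rfl)
      exacts [rfl, h1]
    have := Finset.card_le_card this
    rw [Finset.card_pair (R.facePerm_ne d).symm] at this
    omega
  · have h3 : R.facePerm (R.facePerm d) ≠ d := fun h => hq ⟨d, rfl, h⟩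
    have : ({d, R.facePerm d, R.facePerm (R.facePerm d)} : Finset G.Dart) ⊆
        Finset.univ.filter fun e => R.face e = R.face d := by
      intro e; simp only [Finset.mem_insert, Finset.mem_singleton, Finset.mem_filter,
        Finset.mem_univ, true_and]
      rintro (rfl | rfl | rfl)
      exacts [rfl, h1, h2.trans h1]
    have := Finset.card_le_card this
    rw [Finset.card_eq_three.2 ⟨d, _, _, (R.facePerm_ne d).symm, h3.symm,
      (R.facePerm_ne _).symm, rfl⟩] at this
    omega

/-- A component for every isolated vertex and for every face of length two. -/
noncomputable def smallComponent : G.Isolated ⊕ R.Digon → G.ConnectedComponent :=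
  Sum.elim (fun v => G.connectedComponentMk v.1) fun q => G.connectedComponentMk q.2.choose.fst

theorem smallComponent_injective : Function.Injective R.smallComponent := by
  rintro (v | q) (v' | q') h
  · have h := SimpleGraph.ConnectedComponent.eq.1 h
    rw [Sum.inl.injEq]
    exact Subtype.ext (eq_of_reachable_of_isolated v.2 h)
  · have h := eq_of_reachable_of_isolated v.2 (SimpleGraph.ConnectedComponent.eq.1 h)
    exact absurd (h ▸ q'.2.choose.adj) (v.2 _)
  · have h := eq_of_reachable_of_isolated v'.2 (SimpleGraph.ConnectedComponent.eq.1 h).symm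
    exact absurd (h ▸ q.2.choose.adj) (v'.2 _)
  · have h := SimpleGraph.ConnectedComponent.eq.1 h
    rw [Sum.inr.injEq]
    obtain ⟨h1, h2⟩ := q.2.choose_spec
    obtain ⟨h1', -⟩ := q'.2.choose_spec
    set d := q.2.choose
    set e := q'.2.choose
    have hfst := (R.reachable_iff_of_facePerm_facePerm h2).1 h
    have hsnd := (R.reachable_iff_of_facePerm_facePerm h2).1 (h.trans e.adj.reachable)
    have hface : R.face d = R.face e := by
      have hne := e.adj.ne
      have hde : e = d ∨ e = R.facePerm d := by
        have a := R.facePerm_fst d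
        have b := R.facePerm_fst (R.facePerm d)
        rw [h2] at b
        rcases hfst with hf | hf
        · left
          have hs : e.snd = d.snd := hsnd.resolve_left fun hs => hne (hf.trans hs.symm)
          exact SimpleGraph.Dart.ext _ _ (Prod.ext hf hs)
        · right
          have hs : e.snd = d.fst := hsnd.resolve_right fun hs => hne (hf.trans hs.symm)
          exact SimpleGraph.Dart.ext _ _ (Prod.ext (hf.trans a.symm) (hs.trans b))
      rcases hde with hde | hde
      · rw [hde]
      · rw [hde, face_facePerm]
    exact Subtype.ext (h1.symm.trans (hface.trans h1'))

theorem card_isolated_add_card_digon_le :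
    Nat.card G.Isolated + Nat.card R.Digon ≤ Nat.card G.ConnectedComponent := by
  have := Nat.card_le_card_of_injective _ R.smallComponent_injective
  rwa [Nat.card_sum] at this

/-- A dart off the digons lies in a component that is neither an isolated vertex nor a single edge.
The extra component supplies the `-6` in the edge bound. -/
theorem card_isolated_add_card_digon_lt {d : G.Dart} (hd : R.facePerm (R.facePerm d) ≠ d) :
    Nat.card G.Isolated + Nat.card R.Digon + 1 ≤ Nat.card G.ConnectedComponent := by
  let f : Option (G.Isolated ⊕ R.Digon) → G.ConnectedComponent := fun o =>
    o.elim (G.connectedComponentMk d.fst) R.smallComponent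
  have hne : ∀ z, R.smallComponent z ≠ G.connectedComponentMk d.fst := by
    rintro (v | q) h
    · have h := eq_of_reachable_of_isolated v.2 (SimpleGraph.ConnectedComponent.eq.1 h)
      exact v.2 _ (h ▸ d.adj)
    · have h := SimpleGraph.ConnectedComponent.eq.1 h
      obtain ⟨-, h2⟩ := q.2.choose_spec
      set e := q.2.choose
      have h3 : ∀ x, G.Reachable d.fst x → x = e.fst ∨ x = e.snd := fun x hx =>
        (R.reachable_iff_of_facePerm_facePerm h2).1 (h.trans hx)
      have a := R.facePerm_fst d
      have b := R.facePerm_fst (R.facePerm d)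
      have r1 := h3 _ (.refl _)
      have r2 := h3 _ d.adj.reachable
      have r3 : (R.facePerm d).snd = e.fst ∨ (R.facePerm d).snd = e.snd := h3 _
        (d.adj.reachable.trans (a ▸ (R.facePerm d).adj.reachable))
      have r4 : (R.facePerm (R.facePerm d)).snd = e.fst ∨
          (R.facePerm (R.facePerm d)).snd = e.snd := h3 _
        ((d.adj.reachable.trans (a ▸ (R.facePerm d).adj.reachable)).trans
          (b ▸ (R.facePerm (R.facePerm d)).adj.reachable))
      have n1 := d.adj.ne
      have n2 := (R.facePerm d).adj.ne
      have n3 := (R.facePerm (R.facePerm d)).adj.ne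
      rw [a] at n2
      rw [b] at n3
      apply hd
      apply SimpleGraph.Dart.ext
      apply Prod.ext
      · rw [b]; grind
      · grind
  have hf : Function.Injective f := by
    rintro (_ | x) (_ | y) h
    · rfl
    · exact absurd h.symm (hne y)
    · exact absurd h (hne x)
    · exact congrArg some (R.smallComponent_injective h)
  have := Nat.card_le_card_of_injective f hf
  rwa [Finite.card_option, Nat.card_sum] at this

/-- The number of edges of a graph with a rotation system of genus at most `g`. -/
theorem card_edgeSet_le (W : Finset V) (hW : ∀ u v, G.Adj u v → u ∈ W) (hW3 : 3 ≤ W.card) {g : ℕ}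
    (hR : R.defect ≤ 2 * g) : Nat.card G.edgeSet + 6 ≤ 3 * W.card + 6 * g := by
  have hV : Nat.card V ≤ Nat.card G.Isolated + W.card := by
    classical
    have := Fintype.ofFinite V
    have h1 : W.card + Wᶜ.card = Nat.card V := by
      rw [Nat.card_eq_fintype_card, Finset.card_add_card_compl]
    have h2 : Nat.card (Wᶜ : Finset V) ≤ Nat.card G.Isolated :=
      Nat.card_le_card_of_injective
        (fun v => ⟨v.1, fun w hw => (Finset.mem_compl.1 v.2) (hW _ _ hw)⟩)
        fun v w h => Subtype.ext (by simpa using h)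
    rw [Nat.card_eq_fintype_card, Fintype.card_coe] at h2
    omega
  have h3 := R.three_mul_card_face_le
  have hdef : R.defect = 2 * Nat.card G.ConnectedComponent - Nat.card V + Nat.card G.edgeSet -
    (Nat.card R.Face + Nat.card G.Isolated) := by
    unfold defect numFaces; push_cast; rfl
  by_cases hcase : ∃ d, R.facePerm (R.facePerm d) ≠ d
  · obtain ⟨d, hd⟩ := hcase
    have := R.card_isolated_add_card_digon_lt hd
    omega
  -- All faces are digons, so the graph is a matching and has at most `W.card` edges; here `3 ≤
  -- W.card` is what gives the bound.
  · push Not at hcase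
    have h4 : Nat.card R.Digon = Nat.card R.Face := by
      refine Nat.card_congr (Equiv.subtypeUnivEquiv fun q => ?_)
      obtain ⟨d, rfl⟩ : ∃ d, R.face d = q := Quotient.exists_rep q
      exact ⟨d, rfl, hcase d⟩
    have h5 := R.card_isolated_add_card_digon_le
    have h6 : Nat.card G.edgeSet ≤ Nat.card R.Face := by
      have h8 : ∀ d, R.facePerm d = d.symm := fun d => by
        have b := R.facePerm_fst (R.facePerm d)
        rw [hcase] at b
        exact SimpleGraph.Dart.ext _ _ (Prod.ext (R.facePerm_fst d) b.symm)
      let f : R.Face → G.edgeSet := Quotient.lift (fun d : G.Dart => (⟨d.edge, d.edge_mem⟩ : G.edgeSet))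
        fun _ _ h => Equiv.Perm.SameCycle.of_forall_apply (τ := R.facePerm)
          (r := fun d e : G.Dart => (⟨d.edge, d.edge_mem⟩ : G.edgeSet) = ⟨e.edge, e.edge_mem⟩)
          ⟨fun _ => rfl, fun h => h.symm, fun h h' => h.trans h'⟩
          (fun d => by simp [h8]) h
      refine Nat.card_le_card_of_surjective f ?_
      rintro ⟨e, he⟩
      induction e with | _ u v
      exact ⟨R.face ⟨(u, v), he⟩, rfl⟩
    have h7 : Nat.card G.ConnectedComponent ≤ Nat.card V :=
      Nat.card_le_card_of_surjective G.connectedComponentMk fun c => by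
        induction c using SimpleGraph.ConnectedComponent.ind with | _ x
        exact ⟨x, rfl⟩
    omega

end RotationSystem

/-! ### Edge bound and colouring of biembeddable graphs -/

section Biembeddable

variable {V : Type}

theorem Triangulates.embedsIn {G : SimpleGraph V} {g : ℕ} (h : Triangulates G g) :
    EmbedsIn G g := by
  obtain ⟨-, R, -, hR⟩ := h
  exact ⟨R, g, le_rfl, hR⟩

theorem HasTriangularBiembedding.biembeddable {G : SimpleGraph V} {g : ℕ}
    (h : HasTriangularBiembedding G g) : Biembeddable G g := by
  obtain ⟨A, B, h1, h2, h3⟩ := h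
  exact ⟨A, B, h1, h2.embedsIn, h3.embedsIn⟩

variable [Finite V]

theorem EmbedsIn.card_edgeSet_le {A H : SimpleGraph V} {g : ℕ} (h : EmbedsIn A g) (hH : H ≤ A)
    (W : Finset V) (hW : ∀ u v, H.Adj u v → u ∈ W) (hW3 : 3 ≤ W.card) :
    Nat.card H.edgeSet + 6 ≤ 3 * W.card + 6 * g := by
  obtain ⟨R, k, hk, hR⟩ := h
  obtain ⟨R', hR'⟩ := R.exists_defect_le_of_le hH
  refine R'.card_edgeSet_le W hW hW3 ?_
  rw [RotationSystem.hasGenus_iff] at hR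
  omega

/-- Both halves are cut down to `H`, where monotonicity of the genus and the Euler bound apply. Only
vertices in `W` count, so the bound serves subgraphs on part of the vertices. -/
theorem Biembeddable.card_edgeSet_le {G H : SimpleGraph V} {g : ℕ} (h : Biembeddable G g)
    (hH : H ≤ G) (W : Finset V) (hW : ∀ u v, H.Adj u v → u ∈ W) (hW3 : 3 ≤ W.card) :
    Nat.card H.edgeSet + 12 ≤ 6 * W.card + 12 * g := by
  obtain ⟨A, B, ⟨rfl, -⟩, hA, hB⟩ := h
  have h1 := hA.card_edgeSet_le (H := A ⊓ H) inf_le_left W (fun u v h => hW u v h.2) hW3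
  have h2 := hB.card_edgeSet_le (H := B ⊓ H) inf_le_left W (fun u v h => hW u v h.2) hW3
  have h3 : H.edgeSet = (A ⊓ H).edgeSet ∪ (B ⊓ H).edgeSet := by
    rw [← SimpleGraph.edgeSet_sup, ← inf_sup_right, inf_eq_right.2 hH]
  have h4 := Set.ncard_union_le (A ⊓ H).edgeSet (B ⊓ H).edgeSet
  rw [← h3] at h4
  change Nat.card H.edgeSet ≤ Nat.card _ + Nat.card _ at h4
  omega

/-- A graph all of whose induced subgraphs of more than `n` vertices have fewer edges than the
minimum degree `n` requires can be coloured greedily with `n` colours. -/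
theorem SimpleGraph.colorable_of_forall_card_edgeSet_lt {G : SimpleGraph V} {n : ℕ}
    (hG : ∀ (H : SimpleGraph V) (W : Finset V), H ≤ G → (∀ u v, H.Adj u v → u ∈ W) →
      n < W.card → 2 * Nat.card H.edgeSet < n * W.card) : G.Colorable n := by
  classical
  have := Fintype.ofFinite V
  -- The colour in `Unit` is a dummy for vertices outside `W`; it keeps the induction meaningful
  -- when `n = 0`.
  suffices ∀ W : Finset V, ∃ C : V → Fin n ⊕ Unit, ∀ u ∈ W, (∃ i, C u = Sum.inl i) ∧
      ∀ v ∈ W, G.Adj u v → C u ≠ C v by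
    obtain ⟨C, hC⟩ := this Finset.univ
    choose f hf using fun u => (hC u (Finset.mem_univ u)).1
    refine ⟨SimpleGraph.Coloring.mk f fun {u v} huv h => ?_⟩
    exact (hC u (Finset.mem_univ u)).2 v (Finset.mem_univ v) huv (by rw [hf, hf, h])
  intro W
  induction W using Finset.strongInduction with
  | H W ih =>
    obtain hW | hW := le_or_gt W.card n
    · obtain ⟨f⟩ : Nonempty (W ↪ Fin n) :=
        Function.Embedding.nonempty_of_card_le (by simpa using hW)
      refine ⟨fun v => if h : v ∈ W then Sum.inl (f ⟨v, h⟩) else Sum.inr (), fun u hu =>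
        ⟨⟨_, dif_pos hu⟩, fun v hv huv h => ?_⟩⟩
      simp only at h
      rw [dif_pos hu, dif_pos hv, Sum.inl.injEq, f.injective.eq_iff, Subtype.mk.injEq] at h
      exact huv.ne h
    · let H : SimpleGraph V :=
        { Adj := fun u v => G.Adj u v ∧ u ∈ W ∧ v ∈ W
          symm := ⟨fun u v h => ⟨h.1.symm, h.2.2, h.2.1⟩⟩
          loopless := ⟨fun u h => G.loopless.irrefl u h.1⟩ }
      have h1 := hG H W (fun u v h => h.1) (fun u v h => h.2.1) hW
      obtain ⟨v, hv, hdeg⟩ : ∃ v ∈ W, H.degree v < n := by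
        by_contra! hcon
        have h2 := H.sum_degrees_eq_twice_card_edges
        rw [← SimpleGraph.card_edgeSet, ← Nat.card_eq_fintype_card] at h2
        have h3 : ∑ v ∈ W, n ≤ ∑ v, H.degree v :=
          (Finset.sum_le_sum hcon).trans (Finset.sum_le_sum_of_subset (Finset.subset_univ _))
        rw [Finset.sum_const, smul_eq_mul, mul_comm] at h3
        omega
      obtain ⟨C, hC⟩ := ih (W.erase v) (Finset.erase_ssubset hv)
      obtain ⟨i, hi⟩ : ∃ i : Fin n, Sum.inl i ∉ (H.neighborFinset v).image C := by
        by_contra! hcon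
        have h2 : (Finset.univ : Finset (Fin n)).image Sum.inl ⊆ (H.neighborFinset v).image C := by
          intro x hx
          obtain ⟨i, -, rfl⟩ := Finset.mem_image.1 hx
          exact hcon i
        have h3 := (Finset.card_le_card h2).trans Finset.card_image_le
        rw [Finset.card_image_of_injective _ Sum.inl_injective, Finset.card_univ, Fintype.card_fin,
          SimpleGraph.card_neighborFinset_eq_degree] at h3
        omega
      have hi' : ∀ w ∈ W, G.Adj v w → C w ≠ Sum.inl i := fun w hw hvw h =>
        hi (Finset.mem_image.2 ⟨w, (H.mem_neighborFinset _ _).2 ⟨hvw, hv, hw⟩, h⟩)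
      refine ⟨Function.update C v (Sum.inl i), fun u hu => ⟨?_, fun w hw huw => ?_⟩⟩
      · by_cases huv : u = v
        · exact ⟨i, by rw [huv, Function.update_self]⟩
        · rw [Function.update_of_ne huv]
          exact (hC u (Finset.mem_erase.2 ⟨huv, hu⟩)).1
      · by_cases huv : u = v
        · subst huv
          rw [Function.update_self, Function.update_of_ne huw.ne']
          exact (hi' w hw huw).symm
        · rw [Function.update_of_ne huv]
          by_cases hwv : w = v
          · subst hwv
            rw [Function.update_self]
            exact hi' u hu huw.symm
          · rw [Function.update_of_ne hwv]
            exact (hC u (Finset.mem_erase.2 ⟨huv, hu⟩)).2 w (Finset.mem_erase.2 ⟨hwv, hw⟩) huw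

end Biembeddable

/-! ### Bigenus and bichromatic number from a triangular biembedding -/

theorem card_edgeSet_top_fin (n : ℕ) :
    2 * Nat.card (⊤ : SimpleGraph (Fin n)).edgeSet = n * (n - 1) := by
  classical
  rw [Nat.card_eq_fintype_card, SimpleGraph.card_edgeSet, SimpleGraph.card_edgeFinset_top_eq_card_choose_two,
    Fintype.card_fin, Nat.choose_two_right, Nat.mul_div_cancel' (Nat.even_mul_pred_self n).two_dvd]

theorem le_of_biembeddable_top {s g : ℕ}
    (h : Biembeddable (⊤ : SimpleGraph (Fin (24 * s + 21))) g) : 24 * s ^ 2 + 29 * s + 8 ≤ g := by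
  have h1 := h.card_edgeSet_le le_rfl Finset.univ (fun u _ _ => Finset.mem_univ u) (by simp)
  have h2 := card_edgeSet_top_fin (24 * s + 21)
  rw [Finset.card_univ, Fintype.card_fin] at h1
  have h3 : 24 * s + 21 - 1 = 24 * s + 20 := by omega
  rw [h3] at h2
  nlinarith

/-- With `n = 24s + 21` and `w > n` vertices, `2 |E| ≤ 12 w + n (n - 13)`, and this is less than `n
w` because `(n - 12)(n + 1) > n (n - 13)`. -/
theorem colorable_of_biembeddable {V : Type} [Finite V] {G : SimpleGraph V} {s : ℕ}
    (h : Biembeddable G (24 * s ^ 2 + 29 * s + 8)) : G.Colorable (24 * s + 21) := by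
  refine SimpleGraph.colorable_of_forall_card_edgeSet_lt fun H W hH hW hcard => ?_
  have h1 := h.card_edgeSet_le hH W hW (by omega)
  obtain ⟨k, hk⟩ := Nat.exists_eq_add_of_lt hcard
  rw [hk] at h1 ⊢
  nlinarith

theorem main_of_hasTriangularBiembedding (s : ℕ)
    (h : HasTriangularBiembedding (⊤ : SimpleGraph (Fin (24 * s + 21)))
      (24 * s ^ 2 + 29 * s + 8)) :
    bigenus (⊤ : SimpleGraph (Fin (24 * s + 21))) = 24 * s ^ 2 + 29 * s + 8 ∧
    (bigenus (⊤ : SimpleGraph (Fin (24 * s + 21))) : ℤ) =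
      ⌈(((24 * s + 21 : ℕ) : ℚ) ^ 2 - 13 * ((24 * s + 21 : ℕ) : ℚ) + 24) / 24⌉ ∧
    bichromaticNumber (24 * s ^ 2 + 29 * s + 8) = 24 * s + 21 ∧
    (bichromaticNumber (24 * s ^ 2 + 29 * s + 8) : ℤ) =
      ⌊(13 + Real.sqrt (73 + 96 * ((24 * s ^ 2 + 29 * s + 8 : ℕ) : ℝ))) / 2⌋ := by
  have h1 : bigenus (⊤ : SimpleGraph (Fin (24 * s + 21))) = 24 * s ^ 2 + 29 * s + 8 :=
    IsLeast.csInf_eq ⟨h.biembeddable, fun _ hg => le_of_biembeddable_top hg⟩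
  have h2 : bichromaticNumber (24 * s ^ 2 + 29 * s + 8) = 24 * s + 21 := by
    refine IsGreatest.csSup_eq ⟨⟨24 * s + 21, ⊤, h.biembeddable, ?_⟩, ?_⟩
    · rw [SimpleGraph.chromaticNumber_top, Fintype.card_fin]
    · rintro k ⟨m, G, hG, hk⟩
      have := (colorable_of_biembeddable hG).chromaticNumber_le
      rw [hk] at this
      exact_mod_cast this
  refine ⟨h1, ?_, h2, ?_⟩
  · have : (((24 * s + 21 : ℕ) : ℚ) ^ 2 - 13 * ((24 * s + 21 : ℕ) : ℚ) + 24) / 24 =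
        ((24 * s ^ 2 + 29 * s + 8 : ℕ) : ℤ) := by push_cast; ring
    rw [h1, this, Int.ceil_intCast]
  -- The radicand is the square of `2n - 13`.
  · have h3 : (73 + 96 * ((24 * s ^ 2 + 29 * s + 8 : ℕ) : ℝ)) = (48 * s + 29) ^ 2 := by
      push_cast; ring
    have h4 : (13 + Real.sqrt (73 + 96 * ((24 * s ^ 2 + 29 * s + 8 : ℕ) : ℝ))) / 2 =
        ((24 * s + 21 : ℕ) : ℤ) := by
      rw [h3, Real.sqrt_sq (by positivity)]; push_cast; ring
    rw [h2, h4, Int.floor_intCast]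

/-! ### From oriented triangles to rotation systems -/

/-- A family of oriented triangles that fits together to a triangulation: `tri u v w` says that
there is a face with the boundary walk `u, v, w`. -/
structure OrientedTriangulation (V : Type) where
  tri : V → V → V → Prop
  rotate : ∀ {u v w}, tri u v w → tri v w u
  unique : ∀ {u v w w'}, tri u v w → tri u v w' → w = w'
  ne : ∀ {u v w}, tri u v w → u ≠ v
  reverse : ∀ {u v w}, tri u v w → ∃ w', tri v u w'
  -- `tri x v y` makes `y` the successor of `x` around `v`; connectedness of this relation says that
  -- the rotation is one cycle.
  link : ∀ {u u' v w w'}, tri v u w → tri v u' w' →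
    Relation.EqvGen (fun x y => tri x v y) u u'

namespace OrientedTriangulation

variable {V : Type} (S : OrientedTriangulation V)

/-- The graph of the edges of the triangles. -/
def graph : SimpleGraph V where
  Adj u v := ∃ w, S.tri u v w
  symm := ⟨fun _ _ h => S.reverse h.choose_spec⟩
  loopless := ⟨fun _ h => S.ne h.choose_spec rfl⟩

theorem adj_of_tri {u v w : V} (h : S.tri u v w) : S.graph.Adj u v := ⟨w, h⟩

/-- The next arc on the boundary of the triangle of an arc. -/
noncomputable def next (d : S.graph.Dart) : S.graph.Dart :=
  ⟨(d.snd, d.adj.choose), S.adj_of_tri (S.rotate d.adj.choose_spec)⟩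

theorem tri_next (d : S.graph.Dart) : S.tri d.fst d.snd (S.next d).snd := d.adj.choose_spec

theorem next_eq {u v w : V} (h : S.graph.Adj u v) (h' : S.tri u v w) :
    S.next ⟨(u, v), h⟩ = ⟨(v, w), S.adj_of_tri (S.rotate h')⟩ :=
  SimpleGraph.Dart.ext _ _ (Prod.ext rfl (S.unique (S.tri_next ⟨(u, v), h⟩) h'))

theorem next_next_next (d : S.graph.Dart) : S.next (S.next (S.next d)) = d := by
  have key : ∀ u v w (h : S.graph.Adj u v), S.tri u v w →
      S.next (S.next (S.next ⟨(u, v), h⟩)) = ⟨(u, v), h⟩ := fun u v w h h1 => by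
    rw [S.next_eq h h1, S.next_eq _ (S.rotate h1), S.next_eq _ (S.rotate (S.rotate h1))]
  exact key d.fst d.snd _ d.adj (S.tri_next d)

/-- The permutation of the arcs that runs around the triangles. -/
noncomputable def nextPerm : Equiv.Perm S.graph.Dart where
  toFun := S.next
  invFun d := S.next (S.next d)
  left_inv := S.next_next_next
  right_inv := S.next_next_next

/-- The rotation system of an oriented triangulation. -/
noncomputable def rotationSystem : RotationSystem S.graph where
  rot := (SimpleGraph.Dart.symm_involutive (G := S.graph)).toPerm.trans S.nextPerm
  rot_fst _ := rfl
  rot_sameCycle d e hde := by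
    obtain ⟨⟨v, u⟩, w, h⟩ := d
    obtain ⟨⟨v', u'⟩, w', h'⟩ := e
    obtain rfl : v = v' := hde
    set ρ : Equiv.Perm S.graph.Dart := (SimpleGraph.Dart.symm_involutive (G := S.graph)).toPerm.trans S.nextPerm
    suffices ∀ x y, Relation.EqvGen (fun x y => S.tri x v y) x y → x = y ∨
        ∃ hx hy, ρ.SameCycle ⟨(v, x), hx⟩ ⟨(v, y), hy⟩ by
      rcases this u u' (S.link h h') with rfl | ⟨hx, hy, h⟩
      exacts [.refl _ _, h]
    intro x y hxy
    induction hxy with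
    | refl x => exact Or.inl rfl
    | rel x y h =>
      have hx : S.graph.Adj v x := (S.adj_of_tri h).symm
      refine Or.inr ⟨hx, S.adj_of_tri (S.rotate h), ?_⟩
      have : ρ ⟨(v, x), hx⟩ = ⟨(v, y), S.adj_of_tri (S.rotate h)⟩ := S.next_eq hx.symm h
      rw [← this]
      exact Equiv.Perm.sameCycle_apply_right.2 (.refl _ _)
    | symm x y _ ih =>
      rcases ih with rfl | ⟨hx, hy, h⟩
      exacts [Or.inl rfl, Or.inr ⟨hy, hx, h.symm⟩]
    | trans x y z _ _ ih1 ih2 =>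
      rcases ih1 with rfl | ⟨hx, hy, h⟩
      · exact ih2
      · rcases ih2 with rfl | ⟨hx', hy', h'⟩
        exacts [Or.inr ⟨hx, hy, h⟩, Or.inr ⟨hx, hy', h.trans h'⟩]

theorem facePerm_eq : S.rotationSystem.facePerm = S.nextPerm := by
  ext1 d
  rw [RotationSystem.facePerm_apply]
  change S.next d.symm.symm = _
  rw [SimpleGraph.Dart.symm_symm]
  rfl

theorem isTriangular (h : ∀ v, ∃ w, S.graph.Adj v w) : S.rotationSystem.IsTriangular := by
  refine ⟨h, fun d => ?_⟩
  have : Fact (Nat.Prime 3) := ⟨Nat.prime_three⟩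
  refine Function.minimalPeriod_eq_prime ?_ (S.rotationSystem.facePerm_ne d)
  rw [S.facePerm_eq]
  exact S.next_next_next d

end OrientedTriangulation

namespace RotationSystem

variable {V : Type} [Finite V] {G : SimpleGraph V} {R : RotationSystem G}

theorem IsTriangular.three_mul_card_face (hR : R.IsTriangular) :
    3 * Nat.card R.Face = Nat.card G.Dart := by
  have h3 : ∀ d, (R.facePerm ^ 3) d = d := fun d => by
    have := Function.isPeriodicPt_minimalPeriod R.facePerm d
    rw [hR.2 d] at this
    rw [← Equiv.Perm.iterate_eq_pow]
    exact this
  have h2 : IsEmpty R.Digon := ⟨fun ⟨q, d, _, hd⟩ => by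
    have : Function.IsPeriodicPt R.facePerm 2 d := hd
    have := this.minimalPeriod_le (by norm_num)
    rw [hR.2 d] at this
    omega⟩
  refine le_antisymm ?_ ?_
  · have := R.three_mul_card_face_le
    rw [← card_dart, Nat.card_of_isEmpty (α := R.Digon)] at this
    exact this
  · let f : R.Face × Fin 3 → G.Dart := fun x => (R.facePerm ^ (x.2 : ℕ)) x.1.out
    have hf : Function.Surjective f := fun d => by
      have h : R.facePerm.SameCycle (R.face d).out d := Quotient.exact (Quotient.out_eq (R.face d))
      obtain ⟨i, -, hi⟩ := h.exists_pow_eq'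
      refine ⟨(R.face d, ⟨i % 3, Nat.mod_lt _ (by norm_num)⟩), ?_⟩
      have hp : R.facePerm ^ 3 = 1 := Equiv.ext h3
      rw [← Nat.mod_add_div i 3, pow_add, pow_mul, hp, one_pow, mul_one] at hi
      exact hi
    have := Nat.card_le_card_of_surjective f hf
    rw [Nat.card_prod, Nat.card_eq_fintype_card (α := Fin 3), Fintype.card_fin] at this
    omega

/-- With `D` darts, `|E| = D / 2` and `|F| = D / 3`, so Euler's formula reads `|V| - D / 6 = 2 -
2g`. -/
theorem IsTriangular.hasGenus (hR : R.IsTriangular) (hG : G.Connected) {g : ℕ}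
    (h : 6 * (Nat.card V : ℤ) - Nat.card G.Dart = 12 - 12 * g) : R.HasGenus g := by
  have h1 := hR.three_mul_card_face
  have h2 := card_dart G
  have h3 : IsEmpty G.Isolated := ⟨fun v => (hR.1 v.1).elim fun w hw => v.2 w hw⟩
  have h4 : Nat.card G.ConnectedComponent = 1 := by
    have := hG.preconnected.subsingleton_connectedComponent
    have := hG.nonempty
    exact Nat.card_of_subsingleton (G.connectedComponentMk (Classical.arbitrary V))
  have h5 : R.numFaces = Nat.card R.Face := by
    unfold numFaces
    rw [Nat.card_of_isEmpty (α := G.Isolated)]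
    rfl
  unfold HasGenus
  rw [h4, h5]
  push_cast
  omega

end RotationSystem

/-! ### Triangle families invariant under translation -/

/-- A family of oriented triangles, up to translation in `ZMod M`, on the vertex set
`ZMod 3 × ZMod M`. The arc from `u` to `v` is described by the class `u.1` and the difference
`v - u`. -/
structure TriangleFamily (M : ℕ) (ι : Type) where
  arc : ι → ZMod 3 → ZMod 3 × (ZMod 3 × ZMod M)
  arc_fst : ∀ i j, (arc i (j + 1)).1 = (arc i j).1 + (arc i j).2.1
  arc_sum : ∀ i j, (arc i j).2 + (arc i (j + 1)).2 + (arc i (j + 2)).2 = 0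

namespace TriangleFamily

variable {M : ℕ} {ι : Type} (F : TriangleFamily M ι)

/-- The arc `(v, γ)` occurs in the family. -/
def Occurs (v : ZMod 3) (γ : ZMod 3 × ZMod M) : Prop := ∃ i j, F.arc i j = (v, γ)

/-- At a vertex of class `v`, the neighbour in direction `y` follows the neighbour in
direction `x`. -/
def Follows (v : ZMod 3) (x y : ZMod 3 × ZMod M) : Prop :=
  ∃ i j, F.arc i j = (v + x.1, -x) ∧ F.arc i (j + 1) = (v, y)

/-- The reverses of the arcs occur as well, and the rotation at a vertex is a single cycle. -/
structure IsRotational : Prop where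
  reverse : ∀ {v γ}, F.Occurs v γ → F.Occurs (v + γ.1) (-γ)
  link : ∀ {v γ γ'}, F.Occurs v γ → F.Occurs v γ' → Relation.EqvGen (F.Follows v) γ γ'

/-- Simple sufficient conditions for the connectedness of the graph. -/
structure IsConnecting : Prop where
  exists_loop : ∃ v u, F.Occurs v (0, u) ∧ IsUnit u ∧ ∀ w, ∃ z, F.Occurs w (v - w, z)

section OnVertices

variable {W : Type} (e : W ≃ ZMod 3 × ZMod M)

/-- The triangles of the family on the actual vertices. -/
def Tri (u v w : W) : Prop :=
  ∃ i j, F.arc i j = ((e u).1, e v - e u) ∧ F.arc i (j + 1) = ((e v).1, e w - e v)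

variable {F}

theorem Tri.rotate {u v w : W} (h : F.Tri e u v w) : F.Tri e v w u := by
  obtain ⟨i, j, h1, h2⟩ := h
  refine ⟨i, j + 1, h2, ?_⟩
  have h3 := F.arc_fst i (j + 1)
  have h4 := F.arc_sum i j
  rw [h2] at h3
  rw [h1, h2] at h4
  have e2 : j + 1 + 1 = j + 2 := by ring
  rw [e2] at h3 ⊢
  refine Prod.ext (h3.trans ?_) ?_
  · simp
  · have : (F.arc i (j + 2)).2 = -((e v - e u) + (e w - e v)) :=
      eq_neg_of_add_eq_zero_right h4
    rw [this]; simp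

theorem occurs_iff {u v : W} : F.Occurs (e u).1 (e v - e u) ↔ ∃ w, F.Tri e u v w := by
  constructor
  · rintro ⟨i, j, h⟩
    refine ⟨e.symm (e v + (F.arc i (j + 1)).2), i, j, h, ?_⟩
    refine Prod.ext ?_ (by simp)
    rw [F.arc_fst, h]
    simp
  · rintro ⟨w, i, j, h, -⟩
    exact ⟨i, j, h⟩

/-- The oriented triangulation that a family of triangles describes. -/
def triangulation (hF : F.IsRotational)
    (hinj : Function.Injective fun p : ι × ZMod 3 => F.arc p.1 p.2)
    (hne : ∀ i j, (F.arc i j).2 ≠ 0) : OrientedTriangulation W where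
  tri := F.Tri e
  rotate := Tri.rotate e
  unique := by
    rintro u v w w' ⟨i, j, h1, h2⟩ ⟨i', j', h1', h2'⟩
    obtain ⟨rfl, rfl⟩ := Prod.ext_iff.1 (@hinj (i, j) (i', j') (h1.trans h1'.symm))
    have := congrArg Prod.snd (h2.symm.trans h2')
    exact e.injective (sub_left_injective this)
  ne := by
    rintro u v w ⟨i, j, h1, -⟩ rfl
    exact hne i j (by rw [h1]; simp)
  reverse := by
    intro u v w h
    have h1 := hF.reverse ((occurs_iff e).2 ⟨w, h⟩)
    rw [← occurs_iff]
    simpa using h1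
  link := by
    intro u u' v w w' h h'
    have h1 := hF.link ((occurs_iff e).2 ⟨w, h⟩) ((occurs_iff e).2 ⟨w', h'⟩)
    have key : ∀ x y, Relation.EqvGen (F.Follows (e v).1) x y →
        Relation.EqvGen (fun x y => F.Tri e x v y) (e.symm (e v + x)) (e.symm (e v + y)) := by
      intro x y hxy
      induction hxy with
      | rel x y h =>
        obtain ⟨i, j, h1, h2⟩ := h
        refine .rel _ _ ⟨i, j, ?_, ?_⟩
        · rw [h1]; simp
        · rw [h2]; simp
      | refl x => exact .refl _
      | symm x y _ ih => exact .symm _ _ ih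
      | trans x y z _ _ ih1 ih2 => exact .trans _ _ _ ih1 ih2
    simpa using key _ _ h1

variable (hF : F.IsRotational) (hinj : Function.Injective fun p : ι × ZMod 3 => F.arc p.1 p.2)
  (hne : ∀ i j, (F.arc i j).2 ≠ 0)

theorem triangulation_graph_adj {u v : W} :
    (triangulation e hF hinj hne).graph.Adj u v ↔ F.Occurs (e u).1 (e v - e u) :=
  (occurs_iff e).symm

/-- Each of the three arcs of a triangle orbit has `M` translates, and by `hinj` no dart arises
twice. -/
theorem card_dart_triangulation :
    Nat.card (triangulation e hF hinj hne).graph.Dart = Nat.card ι * 3 * M := by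
  let f : (ι × ZMod 3) × ZMod M → (triangulation e hF hinj hne).graph.Dart := fun p =>
    ⟨(e.symm ((F.arc p.1.1 p.1.2).1, p.2),
      e.symm (((F.arc p.1.1 p.1.2).1, p.2) + (F.arc p.1.1 p.1.2).2)),
      (triangulation_graph_adj e hF hinj hne).2 ⟨p.1.1, p.1.2, by simp⟩⟩
  have hf : Function.Bijective f := by
    constructor
    · rintro ⟨p, z⟩ ⟨p', z'⟩ h
      have h1 : (_, _) = (_, _) := congrArg (fun d => d.toProd) h
      simp only [Prod.mk.injEq, e.symm.injective.eq_iff] at h1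
      obtain ⟨⟨h1, rfl⟩, h2⟩ := h1
      rw [h1] at h2
      rw [@hinj p p' (Prod.ext h1 (add_left_cancel h2))]
    · rintro ⟨⟨u, v⟩, h⟩
      obtain ⟨i, j, h1⟩ := (triangulation_graph_adj e hF hinj hne).1 h
      refine ⟨((i, j), (e u).2), SimpleGraph.Dart.ext _ _ (Prod.ext ?_ ?_)⟩
      · simp [f, h1]
      · simp [f, h1]
  rw [← Nat.card_congr (Equiv.ofBijective f hf), Nat.card_prod, Nat.card_prod,
    Nat.card_zmod, Nat.card_zmod]

/-- Steps by the unit `u` run through the whole class `v`, and every vertex has a neighbour in that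
class. -/
theorem triangulation_connected [NeZero M] (hc : F.IsConnecting) :
    (triangulation e hF hinj hne).graph.Connected := by
  obtain ⟨v, u, h1, ⟨u', hu⟩, h2⟩ := hc.exists_loop
  set G := (triangulation e hF hinj hne).graph
  have hadj : ∀ x γ, F.Occurs x.1 γ → G.Reachable (e.symm x) (e.symm (x + γ)) := fun x γ h =>
    SimpleGraph.Adj.reachable ((triangulation_graph_adj e hF hinj hne).2 (by simpa using h))
  have hmul : ∀ (n : ℕ) (z : ZMod M), G.Reachable (e.symm (v, z)) (e.symm (v, z + n * u)) := by
    intro n z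
    induction n with
    | zero => simp
    | succ k ih =>
      refine ih.trans ?_
      have := hadj (v, z + k * u) (0, u) h1
      convert this using 2
      simp; ring
  have hv : ∀ z, G.Reachable (e.symm (v, 0)) (e.symm (v, z)) := by
    intro z
    obtain ⟨n, hn⟩ : ∃ n : ℕ, (n : ZMod M) = z * (u'⁻¹ : (ZMod M)ˣ) := by
      exact ⟨_, ZMod.natCast_zmod_val _⟩
    have := hmul n 0
    rw [hn, ← hu] at this
    simpa using this
  have hall : ∀ x, G.Reachable (e.symm (v, 0)) x := by
    intro x
    obtain ⟨z, hz⟩ := h2 (e x).1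
    have h3 := hadj (e x) _ hz
    have h4 : e x + (v - (e x).1, z) = (v, (e x).2 + z) := Prod.ext (by simp) rfl
    rw [h4, e.symm_apply_apply] at h3
    exact (hv _).trans h3.symm
  have : Nonempty W := ⟨e.symm (v, 0)⟩
  exact ⟨fun x y => (hall x).symm.trans (hall y)⟩

end OnVertices
end TriangleFamily

/-! ### Two families that cover all arcs -/

theorem injective_of_subset_range {Q X : Type} [Finite Q] (f : Q → X) {S : Set X}
    (hS : S ⊆ Set.range f) (h : Nat.card Q ≤ S.ncard) :
    Function.Injective f ∧ Set.range f = S := by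
  have h1 : (Set.range f).ncard ≤ Nat.card Q := by
    rw [← Set.image_univ, ← Set.ncard_univ]
    exact Set.ncard_image_le Set.finite_univ
  have h2 : S = Set.range f := Set.eq_of_subset_of_ncard_le hS (h1.trans h) (Set.finite_range f)
  refine ⟨?_, h2.symm⟩
  have h3 : (f '' Set.univ).ncard = (Set.univ : Set Q).ncard := by
    rw [Set.image_univ, Set.ncard_univ]
    exact le_antisymm h1 (h2 ▸ h)
  exact Set.injOn_univ.1 (Set.injOn_of_ncard_image_eq h3 Set.finite_univ)

/-- The families have `2k · 3 = 3 (3M - 1)` arcs in all, as many as there are pairs of a class and a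
nonzero difference. So covering forces every arc to occur exactly once, in one family, and
difference zero never occurs. -/
theorem hasTriangularBiembedding_of_triangleFamily {M k g : ℕ} [NeZero M] {ι₁ ι₂ : Type}
    [Finite ι₁] [Finite ι₂] (F₁ : TriangleFamily M ι₁) (F₂ : TriangleFamily M ι₂)
    (h1 : Nat.card ι₁ = k) (h2 : Nat.card ι₂ = k) (hk : 2 * k + 1 = 3 * M)
    (hg : k * M + 4 = 6 * M + 4 * g)
    (hcover : ∀ v γ, γ ≠ 0 → F₁.Occurs v γ ∨ F₂.Occurs v γ)
    (hr1 : F₁.IsRotational) (hr2 : F₂.IsRotational) (hc1 : F₁.IsConnecting)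
    (hc2 : F₂.IsConnecting) :
    HasTriangularBiembedding (⊤ : SimpleGraph (Fin (3 * M))) g := by
  let f : (ι₁ ⊕ ι₂) × ZMod 3 → ZMod 3 × (ZMod 3 × ZMod M) := fun p =>
    p.1.elim (fun i => F₁.arc i p.2) fun i => F₂.arc i p.2
  let S : Set (ZMod 3 × (ZMod 3 × ZMod M)) := Set.univ ×ˢ {0}ᶜ
  have hS : S.ncard = 3 * (3 * M - 1) := by
    rw [Set.ncard_prod, Set.ncard_compl, Set.ncard_univ, Set.ncard_singleton, Nat.card_prod,
      Nat.card_zmod, Nat.card_zmod]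
  obtain ⟨hf, hfS⟩ := injective_of_subset_range f (S := S) (by
    rintro ⟨v, γ⟩ ⟨-, hγ⟩
    rcases hcover v γ hγ with ⟨i, j, h⟩ | ⟨i, j, h⟩
    · exact ⟨(Sum.inl i, j), h⟩
    · exact ⟨(Sum.inr i, j), h⟩) (by
    rw [hS, Nat.card_prod, Nat.card_sum, h1, h2, Nat.card_zmod]; omega)
  have hmem : ∀ p, (f p).2 ≠ 0 := fun p => by
    have : f p ∈ S := hfS ▸ ⟨p, rfl⟩
    exact this.2
  have hi1 : Function.Injective fun p : ι₁ × ZMod 3 => F₁.arc p.1 p.2 := fun p q h => by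
    have := @hf (Sum.inl p.1, p.2) (Sum.inl q.1, q.2) h
    simp only [Prod.mk.injEq, Sum.inl.injEq] at this
    exact Prod.ext this.1 this.2
  have hi2 : Function.Injective fun p : ι₂ × ZMod 3 => F₂.arc p.1 p.2 := fun p q h => by
    have := @hf (Sum.inr p.1, p.2) (Sum.inr q.1, q.2) h
    simp only [Prod.mk.injEq, Sum.inr.injEq] at this
    exact Prod.ext this.1 this.2
  have hn1 : ∀ i j, (F₁.arc i j).2 ≠ 0 := fun i j => hmem (Sum.inl i, j)
  have hn2 : ∀ i j, (F₂.arc i j).2 ≠ 0 := fun i j => hmem (Sum.inr i, j)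
  have hM := NeZero.pos M
  let e : Fin (3 * M) ≃ ZMod 3 × ZMod M := Fintype.equivOfCardEq (by
    rw [Fintype.card_fin, Fintype.card_prod, ZMod.card, ZMod.card])
  have htri : ∀ (ι : Type) [Finite ι] (F : TriangleFamily M ι) (hF : F.IsRotational)
      (hi : Function.Injective fun p : ι × ZMod 3 => F.arc p.1 p.2)
      (hn : ∀ i j, (F.arc i j).2 ≠ 0), F.IsConnecting → Nat.card ι = k →
      Triangulates (TriangleFamily.triangulation e hF hi hn).graph g := by
    intro ι _ F hF hi hn hc hcard
    have hconn := TriangleFamily.triangulation_connected e hF hi hn hc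
    have hT := OrientedTriangulation.isTriangular (TriangleFamily.triangulation e hF hi hn)
      fun v => by
        have : Nontrivial (Fin (3 * M)) := Fin.nontrivial_iff_two_le.2 (by omega)
        exact hconn.preconnected.exists_adj_of_nontrivial v
    refine ⟨hconn, _, hT, hT.hasGenus hconn ?_⟩
    rw [TriangleFamily.card_dart_triangulation, hcard, Nat.card_eq_fintype_card, Fintype.card_fin]
    zify at hg
    push_cast
    linarith
  refine ⟨(TriangleFamily.triangulation e hr1 hi1 hn1).graph,
    (TriangleFamily.triangulation e hr2 hi2 hn2).graph, ⟨?_, ?_⟩,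
    htri _ _ hr1 hi1 hn1 hc1 h1, htri _ _ hr2 hi2 hn2 hc2 h2⟩
  · ext u v
    rw [SimpleGraph.sup_adj, SimpleGraph.top_adj, TriangleFamily.triangulation_graph_adj,
      TriangleFamily.triangulation_graph_adj]
    constructor
    · rintro (⟨i, j, h⟩ | ⟨i, j, h⟩) rfl
      · exact hn1 i j (by rw [h]; simp)
      · exact hn2 i j (by rw [h]; simp)
    · intro h
      exact hcover _ _ (sub_ne_zero.2 (e.injective.ne h.symm))
  · rw [SimpleGraph.disjoint_edgeSet, disjoint_iff]
    ext u v
    simp only [SimpleGraph.inf_adj, SimpleGraph.bot_adj, iff_false, not_and]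
    rw [TriangleFamily.triangulation_graph_adj, TriangleFamily.triangulation_graph_adj]
    rintro ⟨i, j, h⟩ ⟨i', j', h'⟩
    have := @hf (Sum.inl i, j) (Sum.inr i', j') (h.trans h'.symm)
    simp at this

/-! ### Families of triangles with a ladder -/

namespace TriangleFamily

variable {M : ℕ} {ι : Type}

/-- The three arcs of the triangle that starts at class `v` with the differences `a`, `b`, `c`. -/
def tripleArc (T : ZMod 3 × (ZMod 3 × ZMod M) × (ZMod 3 × ZMod M) × (ZMod 3 × ZMod M)) :
    Fin 3 → ZMod 3 × (ZMod 3 × ZMod M) :=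
  ![(T.1, T.2.1), (T.1 + T.2.1.1, T.2.2.1), (T.1 + T.2.1.1 + T.2.2.1.1, T.2.2.2)]

/-- A family of triangles given by triples of differences of sum zero. -/
def ofTriples (P : ι → ZMod 3 × (ZMod 3 × ZMod M) × (ZMod 3 × ZMod M) × (ZMod 3 × ZMod M))
    (hP : ∀ i, (P i).2.1 + (P i).2.2.1 + (P i).2.2.2 = 0) : TriangleFamily M ι where
  arc i j := tripleArc (P i) j
  arc_fst i j := by
    have h := congrArg Prod.fst (hP i)
    simp only [Prod.fst_add, Prod.fst_zero] at h
    obtain rfl | rfl | rfl : j = 0 ∨ j = 1 ∨ j = 2 := by revert j; decide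
    · rfl
    · rfl
    · change (P i).1 = (P i).1 + (P i).2.1.1 + (P i).2.2.1.1 + (P i).2.2.2.1
      rw [add_assoc, add_assoc, ← add_assoc (P i).2.1.1, h, add_zero]
  arc_sum i j := by
    obtain rfl | rfl | rfl : j = 0 ∨ j = 1 ∨ j = 2 := by revert j; decide
    · exact hP i
    · rw [← hP i]
      change (P i).2.2.1 + (P i).2.2.2 + (P i).2.1 = _
      abel
    · rw [← hP i]
      change (P i).2.2.2 + (P i).2.1 + (P i).2.2.1 = _
      abel

variable {P : ι → ZMod 3 × (ZMod 3 × ZMod M) × (ZMod 3 × ZMod M) × (ZMod 3 × ZMod M)}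
  {hP : ∀ i, (P i).2.1 + (P i).2.2.1 + (P i).2.2.2 = 0}

theorem occurs_ofTriples_iff {v γ} : (ofTriples P hP).Occurs v γ ↔
    ∃ i, (v, γ) = ((P i).1, (P i).2.1) ∨ (v, γ) = ((P i).1 + (P i).2.1.1, (P i).2.2.1) ∨
      (v, γ) = ((P i).1 + (P i).2.1.1 + (P i).2.2.1.1, (P i).2.2.2) := by
  constructor
  · rintro ⟨i, j, h⟩
    refine ⟨i, ?_⟩
    obtain rfl | rfl | rfl := (by decide : ∀ j : ZMod 3, j = 0 ∨ j = 1 ∨ j = 2) j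
    exacts [Or.inl h.symm, Or.inr (Or.inl h.symm), Or.inr (Or.inr h.symm)]
  · rintro ⟨i, h | h | h⟩
    exacts [⟨i, (0 : Fin 3), h.symm⟩, ⟨i, (1 : Fin 3), h.symm⟩, ⟨i, (2 : Fin 3), h.symm⟩]

variable {v : ZMod 3} {a b c : ZMod 3 × ZMod M} (i : ι)

theorem follows_first (hi : P i = (v, a, b, c)) : (ofTriples P hP).Follows (v + a.1) (-a) b :=
  ⟨i, (0 : Fin 3), by simp [ofTriples, tripleArc, hi], by
    change tripleArc (P i) 1 = _
    simp [tripleArc, hi]⟩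

theorem follows_second (hi : P i = (v, a, b, c)) :
    (ofTriples P hP).Follows (v + a.1 + b.1) (-b) c :=
  ⟨i, (1 : Fin 3), by simp [ofTriples, tripleArc, hi], by
    change tripleArc (P i) 2 = _
    simp [tripleArc, hi]⟩

theorem follows_third (hi : P i = (v, a, b, c)) : (ofTriples P hP).Follows v (-c) a :=
  ⟨i, (2 : Fin 3), by
    have h := congrArg Prod.fst (hP i)
    simp only [hi, Prod.fst_add, Prod.fst_zero] at h
    have h : a.1 + b.1 = -c.1 := eq_neg_of_add_eq_zero_left h
    simp [ofTriples, tripleArc, hi, add_assoc, h], by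
    change tripleArc (P i) 0 = _
    simp [tripleArc, hi]⟩

end TriangleFamily

/-! ### Finite descriptions with entries linear in `t` -/

/-- A difference whose second entry is a linear form `α t + β`. -/
abbrev FormalArc : Type := ZMod 3 × ℤ × ℤ

/-- A finite description of a series of families of triangles, for the moduli `A t + m`. Such a
family consists of a ladder, with the zigzag `(c, p), (c, q), (c, p + ε), (c, q - ε), …` on one side
and the zigzag `(c', p'), (c', q'), (c', p' - ε), (c', q' + ε), …` on the other side, where
`q' = p + p' - q`, and of finitely many other triangles. All entries are linear forms in `t`. -/
structure LadderData where
  A : ℤ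
  m : ℤ
  c : ZMod 3
  c' : ZMod 3
  p : ℤ × ℤ
  q : ℤ × ℤ
  p' : ℤ × ℤ
  ε : ℤ
  triples : List (ZMod 3 × FormalArc × FormalArc × FormalArc)

namespace LadderData

variable (D : LadderData)

/-- The normal form modulo `A t + m`. -/
def nf (x : FormalArc) : FormalArc :=
  (x.1, x.2.1 % D.A, x.2.2 - D.m * (x.2.1 / D.A))

/-- The normal form of the reverse. -/
def neg (x : FormalArc) : FormalArc := D.nf (-x.1, -x.2.1, -x.2.2)

/-- The first term of the zigzag on the one side. -/
def h₀ : FormalArc := D.nf (D.c, D.p)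
/-- The last term of the zigzag on the one side. -/
def h₁ : FormalArc := D.nf (D.c, D.p.1 + D.ε, D.p.2)
/-- The first term of the zigzag on the other side. -/
def f₀ : FormalArc := D.nf (D.c', D.p')
/-- The last term of the zigzag on the other side. -/
def f₁ : FormalArc := D.nf (D.c', D.p'.1 - D.ε, D.p'.2)

/-- The arcs of the triangles outside the ladder. -/
def arcs : List (ZMod 3 × FormalArc) := D.triples.flatMap fun T =>
  [(T.1, T.2.1), (T.1 + T.2.1.1, T.2.2.1), (T.1 + T.2.1.1 + T.2.2.1.1, T.2.2.2)]

/-- The successor of `x` in the rotation at a vertex of class `v`, by a triangle outside the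
ladder. -/
def follow (v : ZMod 3) (x : FormalArc) : Option FormalArc := D.triples.findSome? fun T =>
  if T.1 + T.2.1.1 = v ∧ D.neg T.2.1 = x then some T.2.2.1
  else if T.1 + T.2.1.1 + T.2.2.1.1 = v ∧ D.neg T.2.2.1 = x then some T.2.2.2
  else if T.1 = v ∧ D.neg T.2.2.2 = x then some T.2.1
  else none

/-- The successor of `x` in the rotation, where a run through the ladder counts as one step. -/
def next (v : ZMod 3) (x : FormalArc) : FormalArc :=
  match D.follow v x with
  | some y => y
  | none => if x = D.h₀ then D.h₁ else if x = D.f₀ then D.f₁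
    else if x = D.neg D.h₁ then D.neg D.h₀ else if x = D.neg D.f₁ then D.neg D.f₀ else x

/-- The rotation at a vertex of class `v`, with the ladder contracted. -/
def rotation (v : ZMod 3) : List FormalArc :=
  -- The length needs no justification: `Valid` checks that the list contains what it should, and
  -- repetitions do no harm.
  List.iterate (D.next v) D.h₀ (D.triples.length + 8)

/-- The finitely many conditions under which the description yields rotations that are single
cycles. -/
structure Valid : Prop where
  -- The sum must be `q (A t + m)` as a linear form, with `q` read off from the constant terms.
  sum_eq_zero : ∀ T ∈ D.triples, T.2.1.1 + T.2.2.1.1 + T.2.2.2.1 = 0 ∧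
    T.2.1.2.1 + T.2.2.1.2.1 + T.2.2.2.2.1 =
      D.A * ((T.2.1.2.2 + T.2.2.1.2.2 + T.2.2.2.2.2) / D.m) ∧
    T.2.1.2.2 + T.2.2.1.2.2 + T.2.2.2.2.2 =
      D.m * ((T.2.1.2.2 + T.2.2.1.2.2 + T.2.2.2.2.2) / D.m)
  reverse : ∀ x ∈ D.arcs, (x.1 + x.2.1, D.neg x.2) ∈ D.arcs ∨
    x.2 ∈ [D.h₀, D.f₀, D.neg D.h₁, D.neg D.f₁]
  -- The ladder itself contains the arcs `h i` only for `i > 0` and `-h i` only for `i < 2 * t`, and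
  -- likewise for `f`; the missing ones must come from the other triangles.
  ends : ∀ v, ∀ x ∈ [D.h₀, D.f₀, D.neg D.h₁, D.neg D.f₁], (v, x) ∈ D.arcs
  rotation_arcs : ∀ x ∈ D.arcs, x.2 ∈ D.rotation x.1
  rotation_ends : ∀ v, ∀ x ∈ [D.f₀, D.neg D.h₀, D.neg D.f₀], x ∈ D.rotation v

instance : Decidable D.Valid :=
  decidable_of_iff (_ ∧ _ ∧ _ ∧ _ ∧ _)
    ⟨fun ⟨h1, h2, h3, h4, h5⟩ => ⟨h1, h2, h3, h4, h5⟩,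
      fun ⟨h1, h2, h3, h4, h5⟩ => ⟨h1, h2, h3, h4, h5⟩⟩

end LadderData

/-! ### The explicit triangles -/

/-- The first of the two graphs. -/
def ladderData₁ : LadderData where
  A := 8
  m := 15
  c := 1
  c' := 1
  p := (7, 12)
  q := (5, 10)
  p' := (1, 3)
  ε := -1
  triples := [(0, (1, 7, 12), (1, 1, 3), (1, 0, 0)),
    (0, (1, 1, 3), (1, 0, 0), (1, 7, 12)),
    (1, (1, 7, 12), (1, 1, 3), (1, 0, 0)),
    (0, (1, 2, 5), (0, 2, 3), (2, 4, 7)),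
    (1, (1, 2, 5), (0, 2, 3), (2, 4, 7)),
    (1, (1, 4, 8), (2, 6, 10), (0, 6, 12)),
    (0, (1, 4, 8), (1, 6, 11), (1, 6, 11)),
    (0, (2, 2, 3), (2, 6, 12), (2, 0, 0)),
    (2, (2, 2, 3), (2, 2, 5), (2, 4, 7)),
    (0, (1, 6, 11), (0, 0, 1), (2, 2, 3)),
    (1, (0, 0, -1), (1, 0, 1), (2, 0, 0)),
    (0, (1, 6, 10), (2, 2, 4), (0, 0, 1)),
    (1, (2, 6, 10), (2, 0, 0), (2, 2, 5)),
    (2, (2, 6, 11), (2, 0, -1), (2, 2, 5)),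
    (1, (2, 6, 11), (0, 2, 3), (1, 0, 1)),
    (1, (1, 2, 4), (0, 6, 12), (2, 0, -1)),
    (0, (2, 2, 4), (0, 0, 1), (1, 6, 10)),
    (0, (2, 6, 10), (1, 4, 8), (0, 6, 12)),
    (0, (2, 0, -1), (2, 2, 4), (2, 6, 12)),
    (0, (1, 2, 4), (1, 6, 10), (1, 0, 1)),
    (0, (2, 6, 12), (1, 2, 4), (0, 0, -1)),
    (0, (2, 6, 11), (0, 0, -1), (1, 2, 5))]

/-- The second of the two graphs. -/
def ladderData₂ : LadderData where
  A := 8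
  m := 15
  c := 2
  c' := 1
  p := (4, 9)
  q := (8, 12)
  p' := (8, 13)
  ε := 1
  triples := [(0, (1, 3, 6), (0, 4, 7), (2, 1, 2)),
    (1, (1, 3, 6), (0, 4, 7), (2, 1, 2)),
    (0, (2, 1, 2), (1, 3, 6), (0, 4, 7)),
    (0, (0, 4, 6), (0, 0, -2), (0, 4, 11)),
    (1, (0, 4, 6), (0, 4, 11), (0, 0, -2)),
    (2, (0, 4, 6), (0, 4, 11), (0, 0, -2)),
    (0, (1, 0, -2), (0, 4, 9), (2, 4, 8)),
    (1, (0, 4, 4), (1, 0, 2), (2, 4, 9)),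
    (1, (1, 0, -2), (0, 4, 9), (2, 4, 8)),
    (2, (0, 4, 4), (1, 0, 2), (2, 4, 9)),
    (2, (1, 0, -2), (0, 4, 9), (2, 4, 8)),
    (0, (0, 4, 4), (1, 0, 2), (2, 4, 9)),
    (0, (0, 0, 2), (2, 4, 6), (1, 4, 7)),
    (0, (0, 4, 5), (2, 0, 1), (1, 4, 9)),
    (0, (0, 4, 8), (1, 4, 9), (2, 0, -2)),
    (0, (0, 4, 10), (1, 0, -1), (2, 4, 6)),
    (0, (2, 0, -2), (2, 0, 1), (2, 0, 1)),
    (0, (1, 4, 7), (1, 4, 9), (1, 0, -1)),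
    (1, (0, 4, 5), (0, 0, 2), (0, 4, 8)),
    (1, (0, 4, 10), (1, 4, 7), (2, 0, -2)),
    (1, (1, 0, -1), (0, 4, 10), (2, 4, 6)),
    (2, (0, 0, 2), (0, 4, 8), (0, 4, 5))]

/-- The first of the two graphs for 21 vertices. -/
def smallData₁ : LadderData where
  -- As `x % 0 = x` and `x / 0 = 0`, the normal form is the identity here, and residues modulo 7 are
  -- written as `-3, …, 3`. The ladder is empty since `t = 0`; its parameters only name an arc that
  -- occurs at every class along with its reverse.
  A := 0
  m := 7
  c := 1
  c' := 1
  p := (0, 2)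
  q := (0, 2)
  p' := (0, 2)
  ε := 0
  triples := [(0, (1, 0, 2), (1, 0, 2), (1, 0, 3)),
    (0, (2, 0, 0), (0, 0, -2), (1, 0, 2)),
    (2, (1, 0, -3), (2, 0, -3), (0, 0, -1)),
    (0, (2, 0, 3), (0, 0, -3), (1, 0, 0)),
    (1, (2, 0, -2), (2, 0, -2), (2, 0, -3)),
    (1, (1, 0, -3), (0, 0, 2), (2, 0, 1)),
    (1, (0, 0, -1), (1, 0, 3), (2, 0, -2)),
    (1, (1, 0, 1), (0, 0, 3), (2, 0, 3)),
    (1, (0, 0, 1), (1, 0, 0), (2, 0, -1)),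
    (2, (0, 0, 1), (2, 0, 0), (1, 0, -1))]

/-- The second of the two graphs for 21 vertices. -/
def smallData₂ : LadderData where
  A := 0
  m := 7
  c := 1
  c' := 1
  p := (0, -2)
  q := (0, -2)
  p' := (0, -2)
  ε := 0
  triples := [(2, (2, 0, 2), (2, 0, -1), (2, 0, -1)),
    (2, (1, 0, -2), (1, 0, -3), (1, 0, -2)),
    (0, (2, 0, 1), (1, 0, 1), (0, 0, -2)),
    (2, (1, 0, -1), (0, 0, -1), (2, 0, 2)),
    (1, (0, 0, 3), (2, 0, -3), (1, 0, 0)),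
    (0, (0, 0, 3), (1, 0, 3), (2, 0, 1)),
    (1, (0, 0, -3), (2, 0, 2), (1, 0, 1)),
    (1, (0, 0, -2), (2, 0, 3), (1, 0, -1)),
    (1, (0, 0, 2), (2, 0, 0), (1, 0, -2)),
    (0, (0, 0, 2), (0, 0, 1), (0, 0, -3))]

theorem ladderData₁_valid : ladderData₁.Valid := by decide +kernel
theorem ladderData₂_valid : ladderData₂.Valid := by decide +kernel
theorem smallData₁_valid : smallData₁.Valid := by decide +kernel
theorem smallData₂_valid : smallData₂.Valid := by decide +kernel

/-! ### Valid descriptions give single-cycle rotations -/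

namespace LadderData

variable (D : LadderData) (t M : ℕ)

/-- The value of a formal arc at `t`. -/
def eval (x : FormalArc) : ZMod 3 × ZMod M := (x.1, ((x.2.1 * t + x.2.2 : ℤ) : ZMod M))

/-- A zigzag. -/
def zigzag (c : ZMod 3) (p q : ℤ × ℤ) (ε : ℤ) (i : ℕ) : ZMod 3 × ZMod M :=
  (c, ((if Even i then p.1 * t + p.2 + ε * (i / 2 : ℕ) else q.1 * t + q.2 - ε * (i / 2 : ℕ) : ℤ) :
    ZMod M))

/-- The zigzag on the one side of the ladder. -/
def h (i : ℕ) : ZMod 3 × ZMod M := zigzag t M D.c D.p D.q D.ε i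

/-- The zigzag on the other side of the ladder. -/
def f (i : ℕ) : ZMod 3 × ZMod M := zigzag t M D.c' D.p' (D.p + D.p' - D.q) (-D.ε) i

/-- A rung of the ladder. -/
def rung (i : ℕ) : ZMod 3 × ZMod M := D.h t M (i + 1) - D.h t M i

/-- The triangles of a family with a ladder. -/
def triple : (ZMod 3 × Fin (2 * t)) ⊕ (ZMod 3 × Fin (2 * t)) ⊕ Fin D.triples.length →
    ZMod 3 × (ZMod 3 × ZMod M) × (ZMod 3 × ZMod M) × (ZMod 3 × ZMod M)
  | .inl (v, i) => (v, -D.rung t M i, -D.h t M i, D.h t M (i + 1))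
  | .inr (.inl (v, i)) => (v, D.rung t M i, -D.f t M i, D.f t M (i + 1))
  | .inr (.inr i) => (D.triples[i].1, eval t M D.triples[i].2.1, eval t M D.triples[i].2.2.1,
      eval t M D.triples[i].2.2.2)

variable {t M}

/-- The zigzags drift in opposite directions and `q' = p + p' - q`. Consequently both sides of the
ladder have the same rungs. -/
theorem h_add_f (i : ℕ) : D.h t M i + D.f t M i = D.h t M 0 + D.f t M 0 := by
  simp only [h, f, zigzag, Prod.mk_add_mk, ← Int.cast_add]
  congr 2
  split_ifs <;> simp_all <;> ring

theorem f_sub_f (i : ℕ) : D.f t M i - D.f t M (i + 1) = D.rung t M i := by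
  rw [rung, sub_eq_sub_iff_add_eq_add, add_comm, D.h_add_f, ← D.h_add_f (i + 1), add_comm]

@[simp] theorem h_fst (i : ℕ) : (D.h t M i).1 = D.c := rfl
@[simp] theorem f_fst (i : ℕ) : (D.f t M i).1 = D.c' := rfl
@[simp] theorem rung_fst (i : ℕ) : (D.rung t M i).1 = 0 := sub_self _

theorem eval_nf (hM : (M : ℤ) = D.A * t + D.m) (x : FormalArc) :
    eval t M (D.nf x) = eval t M x := by
  refine Prod.ext rfl ?_
  have h : x.2.1 % D.A * t + (x.2.2 - D.m * (x.2.1 / D.A)) =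
      x.2.1 * t + x.2.2 - x.2.1 / D.A * M := by
    rw [hM, Int.emod_def]; ring
  simp only [eval, nf, h]
  simp

theorem eval_neg (hM : (M : ℤ) = D.A * t + D.m) (x : FormalArc) :
    eval t M (D.neg x) = -eval t M x := by
  rw [neg, D.eval_nf hM]
  refine Prod.ext rfl ?_
  simp [eval, add_comm]

theorem eval_h₀ (hM : (M : ℤ) = D.A * t + D.m) : eval t M D.h₀ = D.h t M 0 := by
  rw [h₀, D.eval_nf hM]
  simp [eval, h, zigzag]

theorem eval_f₀ (hM : (M : ℤ) = D.A * t + D.m) : eval t M D.f₀ = D.f t M 0 := by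
  rw [f₀, D.eval_nf hM]
  simp [eval, f, zigzag]

theorem eval_h₁ (hM : (M : ℤ) = D.A * t + D.m) : eval t M D.h₁ = D.h t M (2 * t) := by
  rw [h₁, D.eval_nf hM]
  simp [eval, h, zigzag]
  ring

theorem eval_f₁ (hM : (M : ℤ) = D.A * t + D.m) : eval t M D.f₁ = D.f t M (2 * t) := by
  rw [f₁, D.eval_nf hM]
  simp [eval, f, zigzag]
  ring

variable {D}

theorem Valid.triple_sum (hD : D.Valid) (hM : (M : ℤ) = D.A * t + D.m) (i) :
    (D.triple t M i).2.1 + (D.triple t M i).2.2.1 + (D.triple t M i).2.2.2 = 0 := by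
  obtain ⟨v, i⟩ | ⟨v, i⟩ | i := i
  · simp only [triple, rung]; abel
  · simp only [triple, ← D.f_sub_f]; abel
  · obtain ⟨h1, h2, h3⟩ := hD.sum_eq_zero _ (D.triples.getElem_mem i.2)
    refine Prod.ext h1 ?_
    simp only [triple, eval, Prod.snd_add, ← Int.cast_add, Prod.snd_zero]
    rw [ZMod.intCast_zmod_eq_zero_iff_dvd]
    generalize (_ : ℤ) / D.m = q at h2 h3
    refine ⟨q, ?_⟩
    rw [hM]
    simp only [Fin.getElem_fin]
    linear_combination (t : ℤ) * h2 + h3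

variable (hD : D.Valid) (hM : (M : ℤ) = D.A * t + D.m) (v : ZMod 3)

/-- The family of triangles that a valid description yields. -/
def Valid.family : TriangleFamily M
    ((ZMod 3 × Fin (2 * t)) ⊕ (ZMod 3 × Fin (2 * t)) ⊕ Fin D.triples.length) :=
  .ofTriples (D.triple t M) (hD.triple_sum hM)

namespace Valid

theorem occurs_family_iff {γ} : (hD.family hM).Occurs v γ ↔
    (∃ x ∈ D.arcs, v = x.1 ∧ γ = eval t M x.2) ∨ ∃ i < 2 * t, γ = D.rung t M i ∨
      γ = -D.rung t M i ∨ γ = -D.h t M i ∨ γ = -D.f t M i ∨ γ = D.h t M (i + 1) ∨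
      γ = D.f t M (i + 1) := by
  rw [family, TriangleFamily.occurs_ofTriples_iff]
  constructor
  · rintro ⟨⟨w, i⟩ | ⟨w, i⟩ | i, h⟩
    · refine Or.inr ⟨i, i.2, ?_⟩
      simp only [triple, Prod.mk.injEq] at h
      tauto
    · refine Or.inr ⟨i, i.2, ?_⟩
      simp only [triple, Prod.mk.injEq] at h
      tauto
    · refine Or.inl ?_
      have hi := D.triples.getElem_mem i.2
      simp only [triple, Prod.mk.injEq] at h
      simp only [arcs, List.mem_flatMap]
      obtain ⟨h1, h2⟩ | ⟨h1, h2⟩ | ⟨h1, h2⟩ := h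
      · exact ⟨_, ⟨_, hi, .head _⟩, h1, h2⟩
      · exact ⟨_, ⟨_, hi, .tail _ (.head _)⟩, h1, h2⟩
      · exact ⟨_, ⟨_, hi, .tail _ (.tail _ (.head _))⟩, h1, h2⟩
  · rintro (⟨x, hx, rfl, rfl⟩ | ⟨i, hi, h⟩)
    · simp only [arcs, List.mem_flatMap] at hx
      obtain ⟨T, hT, hx⟩ := hx
      obtain ⟨i, hi, rfl⟩ := List.getElem_of_mem hT
      refine ⟨.inr (.inr ⟨i, hi⟩), ?_⟩
      simp only [List.mem_cons, List.not_mem_nil, or_false] at hx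
      simp only [triple]
      obtain rfl | rfl | rfl := hx
      exacts [Or.inl rfl, Or.inr (Or.inl rfl), Or.inr (Or.inr rfl)]
    · obtain rfl | rfl | rfl | rfl | rfl | rfl := h
      · exact ⟨.inr (.inl (v, ⟨i, hi⟩)), Or.inl rfl⟩
      · exact ⟨.inl (v, ⟨i, hi⟩), Or.inl rfl⟩
      · exact ⟨.inl (v, ⟨i, hi⟩), Or.inr (Or.inl (by simp [triple]))⟩
      · exact ⟨.inr (.inl (v, ⟨i, hi⟩)), Or.inr (Or.inl (by simp [triple]))⟩
      · exact ⟨.inl (v + D.c, ⟨i, hi⟩), Or.inr (Or.inr (by simp [triple]))⟩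
      · exact ⟨.inr (.inl (v + D.c', ⟨i, hi⟩)), Or.inr (Or.inr (by simp [triple]))⟩

theorem occurs_arc {x} (hx : x ∈ D.arcs) : (hD.family hM).Occurs x.1 (eval t M x.2) :=
  (hD.occurs_family_iff hM _).2 (Or.inl ⟨x, hx, rfl, rfl⟩)

theorem occurs_rung {i : ℕ} (hi : i < 2 * t) : (hD.family hM).Occurs v (D.rung t M i) :=
  (hD.occurs_family_iff hM _).2 (Or.inr ⟨i, hi, by tauto⟩)

theorem occurs_neg_rung {i : ℕ} (hi : i < 2 * t) : (hD.family hM).Occurs v (-D.rung t M i) :=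
  (hD.occurs_family_iff hM _).2 (Or.inr ⟨i, hi, by tauto⟩)

theorem occurs_h {i : ℕ} (hi : i ≤ 2 * t) : (hD.family hM).Occurs v (D.h t M i) := by
  obtain _ | i := i
  · rw [← D.eval_h₀ hM]
    exact hD.occurs_arc hM (hD.ends v _ (.head _))
  · exact (hD.occurs_family_iff hM _).2 (Or.inr ⟨i, hi, by tauto⟩)

theorem occurs_f {i : ℕ} (hi : i ≤ 2 * t) : (hD.family hM).Occurs v (D.f t M i) := by
  obtain _ | i := i
  · rw [← D.eval_f₀ hM]
    exact hD.occurs_arc hM (hD.ends v _ (.tail _ (.head _)))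
  · exact (hD.occurs_family_iff hM _).2 (Or.inr ⟨i, hi, by tauto⟩)

theorem occurs_neg_h {i : ℕ} (hi : i ≤ 2 * t) : (hD.family hM).Occurs v (-D.h t M i) := by
  obtain hi | rfl := hi.lt_or_eq
  · exact (hD.occurs_family_iff hM _).2 (Or.inr ⟨i, hi, by tauto⟩)
  · rw [← D.eval_h₁ hM, ← D.eval_neg hM]
    exact hD.occurs_arc hM (hD.ends v _ (.tail _ (.tail _ (.head _))))

theorem occurs_neg_f {i : ℕ} (hi : i ≤ 2 * t) : (hD.family hM).Occurs v (-D.f t M i) := by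
  obtain hi | rfl := hi.lt_or_eq
  · exact (hD.occurs_family_iff hM _).2 (Or.inr ⟨i, hi, by tauto⟩)
  · rw [← D.eval_f₁ hM, ← D.eval_neg hM]
    exact hD.occurs_arc hM (hD.ends v _ (.tail _ (.tail _ (.tail _ (.head _)))))

theorem occurs_reverse {v γ} (h : (hD.family hM).Occurs v γ) :
    (hD.family hM).Occurs (v + γ.1) (-γ) := by
  obtain ⟨x, hx, rfl, rfl⟩ | ⟨i, hi, h⟩ := (hD.occurs_family_iff hM _).1 h
  · obtain h | h := hD.reverse x hx
    · have := hD.occurs_arc hM h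
      rwa [D.eval_neg hM] at this
    · simp only [List.mem_cons, List.not_mem_nil, or_false] at h
      obtain h | h | h | h := h <;> rw [h] <;>
        simp only [D.eval_neg hM, D.eval_h₀ hM, D.eval_f₀ hM, D.eval_h₁ hM, D.eval_f₁ hM, neg_neg]
      exacts [hD.occurs_neg_h hM _ (Nat.zero_le _), hD.occurs_neg_f hM _ (Nat.zero_le _),
        hD.occurs_h hM _ le_rfl, hD.occurs_f hM _ le_rfl]
  · obtain rfl | rfl | rfl | rfl | rfl | rfl := h <;> try simp only [neg_neg]
    exacts [hD.occurs_neg_rung hM _ hi, hD.occurs_rung hM _ hi, hD.occurs_h hM _ hi.le,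
      hD.occurs_f hM _ hi.le, hD.occurs_neg_h hM _ hi, hD.occurs_neg_f hM _ hi]

/-- The two directions belong to the same cycle of the rotation. -/
def Linked : ZMod 3 × ZMod M → ZMod 3 × ZMod M → Prop :=
  Relation.EqvGen ((hD.family hM).Follows v)

variable {hD hM v}

theorem Linked.symm {x y} (h : hD.Linked hM v x y) : hD.Linked hM v y x := Relation.EqvGen.symm _ _ h

theorem Linked.trans {x y z} (h : hD.Linked hM v x y) (h' : hD.Linked hM v y z) :
    hD.Linked hM v x z := Relation.EqvGen.trans _ _ _ h h'

theorem linked_of_follows {v w : ZMod 3} {x y} (h : (hD.family hM).Follows v x y) (hv : v = w) :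
    hD.Linked hM w x y := hv ▸ .rel _ _ h

/-- The six corners of the two triangles at a rung. Both kinds of triangle exist at every class, so
`v` is arbitrary. -/
theorem linked_rung {i : ℕ} (hi : i < 2 * t) :
    hD.Linked hM v (D.rung t M i) (-D.h t M i) ∧ hD.Linked hM v (D.h t M i) (D.h t M (i + 1)) ∧
      hD.Linked hM v (-D.h t M (i + 1)) (-D.rung t M i) ∧
      hD.Linked hM v (-D.rung t M i) (-D.f t M i) ∧
      hD.Linked hM v (D.f t M i) (D.f t M (i + 1)) ∧
      hD.Linked hM v (-D.f t M (i + 1)) (D.rung t M i) := by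
  refine ⟨?_, ?_, ?_, ?_, ?_, ?_⟩
  · simpa using linked_of_follows
      (TriangleFamily.follows_first (.inl (v, ⟨i, hi⟩)) rfl) (w := v) (by simp)
  · simpa using linked_of_follows
      (TriangleFamily.follows_second (.inl (v + D.c, ⟨i, hi⟩)) rfl) (w := v) (by simp)
  · exact linked_of_follows (TriangleFamily.follows_third (.inl (v, ⟨i, hi⟩)) rfl) rfl
  · exact linked_of_follows
      (TriangleFamily.follows_first (.inr (.inl (v, ⟨i, hi⟩))) rfl) (w := v) (by simp)
  · simpa using linked_of_follows
      (TriangleFamily.follows_second (.inr (.inl (v + D.c', ⟨i, hi⟩))) rfl) (w := v) (by simp)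
  · exact linked_of_follows (TriangleFamily.follows_third (.inr (.inl (v, ⟨i, hi⟩))) rfl) rfl

theorem linked_h {i : ℕ} (hi : i ≤ 2 * t) : hD.Linked hM v (D.h t M 0) (D.h t M i) := by
  induction i with
  | zero => exact .refl _
  | succ i ih => exact (ih (by omega)).trans (linked_rung (by omega)).2.1

theorem linked_f {i : ℕ} (hi : i ≤ 2 * t) : hD.Linked hM v (D.f t M 0) (D.f t M i) := by
  induction i with
  | zero => exact .refl _
  | succ i ih => exact (ih (by omega)).trans (linked_rung (by omega)).2.2.2.2.1

theorem linked_neg_succ {i : ℕ} (hi : i < 2 * t) :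
    hD.Linked hM v (-D.h t M (i + 1)) (-D.f t M i) ∧
      hD.Linked hM v (-D.f t M (i + 1)) (-D.h t M i) :=
  have h := linked_rung (hD := hD) (hM := hM) (v := v) hi
  ⟨h.2.2.1.trans h.2.2.2.1, h.2.2.2.2.2.trans h.1⟩

/-- The run through the negatives changes sides at every rung, so after an even number of rungs it
is back on its own side. -/
theorem linked_neg {i : ℕ} (hi : i ≤ t) :
    hD.Linked hM v (-D.h t M (2 * i)) (-D.h t M 0) ∧
      hD.Linked hM v (-D.f t M (2 * i)) (-D.f t M 0) := by
  induction i with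
  | zero => exact ⟨.refl _, .refl _⟩
  | succ i ih =>
    have h1 := linked_neg_succ (hD := hD) (hM := hM) (v := v) (i := 2 * i) (by omega)
    have h2 := linked_neg_succ (hD := hD) (hM := hM) (v := v) (i := 2 * i + 1) (by omega)
    exact ⟨(h2.1.trans h1.2).trans (ih (by omega)).1, (h2.2.trans h1.1).trans (ih (by omega)).2⟩

theorem linked_follow {x y} (h : D.follow v x = some y) :
    hD.Linked hM v (eval t M x) (eval t M y) := by
  obtain ⟨T, hT, h⟩ := List.exists_of_findSome?_eq_some h
  obtain ⟨i, hi, rfl⟩ := List.getElem_of_mem hT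
  split_ifs at h with h1 h2 h3
  · obtain rfl := Option.some.inj h
    obtain ⟨rfl, rfl⟩ := h1
    rw [D.eval_neg hM]
    exact linked_of_follows (TriangleFamily.follows_first (.inr (.inr ⟨i, hi⟩)) rfl) rfl
  · obtain rfl := Option.some.inj h
    obtain ⟨rfl, rfl⟩ := h2
    rw [D.eval_neg hM]
    exact linked_of_follows (TriangleFamily.follows_second (.inr (.inr ⟨i, hi⟩)) rfl) rfl
  · obtain rfl := Option.some.inj h
    obtain ⟨rfl, rfl⟩ := h3
    rw [D.eval_neg hM]
    exact linked_of_follows (TriangleFamily.follows_third (.inr (.inr ⟨i, hi⟩)) rfl) rfl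

theorem linked_next (x) : hD.Linked hM v (eval t M x) (eval t M (D.next v x)) := by
  unfold next
  split
  · next y h => exact linked_follow h
  · split_ifs with h1 h2 h3 h4
    · rw [h1, D.eval_h₀ hM, D.eval_h₁ hM]; exact linked_h le_rfl
    · rw [h2, D.eval_f₀ hM, D.eval_f₁ hM]; exact linked_f le_rfl
    · rw [h3, D.eval_neg hM, D.eval_neg hM, D.eval_h₀ hM, D.eval_h₁ hM]
      exact (linked_neg le_rfl).1
    · rw [h4, D.eval_neg hM, D.eval_neg hM, D.eval_f₀ hM, D.eval_f₁ hM]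
      exact (linked_neg le_rfl).2
    · exact .refl _

theorem linked_of_mem_rotation {x} (h : x ∈ D.rotation v) :
    hD.Linked hM v (D.h t M 0) (eval t M x) := by
  obtain ⟨n, -, rfl⟩ := List.mem_iterate.1 h
  clear h
  induction n with
  | zero => rw [← D.eval_h₀ hM]; exact .refl _
  | succ n ih =>
    rw [Function.iterate_succ_apply']
    exact ih.trans (linked_next _)

/-- Arcs of listed triangles are in the contracted rotation by validity. Arcs inside the ladder lie
on runs from its ends, and these ends are in that rotation too; the parity of `i` decides which
side's end is met. -/
theorem linked_of_occurs {γ} (h : (hD.family hM).Occurs v γ) :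
    hD.Linked hM v (D.h t M 0) γ := by
  have hf : hD.Linked hM v (D.h t M 0) (D.f t M 0) := by
    rw [← D.eval_f₀ hM]; exact linked_of_mem_rotation (hD.rotation_ends v _ (.head _))
  have hh' : hD.Linked hM v (D.h t M 0) (-D.h t M 0) := by
    rw [← D.eval_h₀ hM, ← D.eval_neg hM, D.eval_h₀ hM]
    exact linked_of_mem_rotation (hD.rotation_ends v _ (.tail _ (.head _)))
  have hf' : hD.Linked hM v (D.h t M 0) (-D.f t M 0) := by
    rw [← D.eval_f₀ hM, ← D.eval_neg hM]
    exact linked_of_mem_rotation (hD.rotation_ends v _ (.tail _ (.tail _ (.head _))))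
  obtain ⟨x, hx, rfl, rfl⟩ | ⟨i, hi, h⟩ := (hD.occurs_family_iff hM _).1 h
  · exact linked_of_mem_rotation (hD.rotation_arcs x hx)
  · have hneg : hD.Linked hM v (D.h t M 0) (-D.h t M i) ∧
        hD.Linked hM v (D.h t M 0) (-D.f t M i) := by
      obtain ⟨j, rfl | rfl⟩ := i.even_or_odd'
      · have := linked_neg (hD := hD) (hM := hM) (v := v) (i := j) (by omega)
        exact ⟨hh'.trans this.1.symm, hf'.trans this.2.symm⟩
      · have h1 := linked_neg (hD := hD) (hM := hM) (v := v) (i := j) (by omega)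
        have h2 := linked_neg_succ (hD := hD) (hM := hM) (v := v) (i := 2 * j) (by omega)
        exact ⟨(hf'.trans h1.2.symm).trans h2.1.symm, (hh'.trans h1.1.symm).trans h2.2.symm⟩
    have hr := linked_rung (hD := hD) (hM := hM) (v := v) hi
    obtain rfl | rfl | rfl | rfl | rfl | rfl := h
    exacts [hneg.1.trans hr.1.symm, hneg.2.trans hr.2.2.2.1.symm, hneg.1, hneg.2, linked_h hi,
      hf.trans (linked_f hi)]

variable (hD hM)

theorem isRotational : (hD.family hM).IsRotational where
  reverse := hD.occurs_reverse hM
  link h h' := (linked_of_occurs h).symm.trans (linked_of_occurs h')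

end Valid

end LadderData

/-! ### Membership of explicit differences -/

namespace LadderData

variable {D : LadderData} {t M : ℕ} (hD : D.Valid) (hM : (M : ℤ) = D.A * t + D.m) {v : ZMod 3}
  {n : ℤ} (k : ℤ)

theorem _root_.ZMod.intCast_eq_of_eq_add_mul {a : ℤ} (h : n = a + k * M) :
    (a : ZMod M) = (n : ZMod M) := by
  rw [h]; simp

namespace Valid

theorem occurs_of_mem_arcs {c : ZMod 3} (α β : ℤ) (hx : (v, c, α, β) ∈ D.arcs)
    (hn : n = α * t + β + k * M) : (hD.family hM).Occurs v (c, (n : ZMod M)) := by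
  rw [← ZMod.intCast_eq_of_eq_add_mul k hn]
  exact hD.occurs_arc hM hx

theorem occurs_h_even (j : ℕ) (hj : j ≤ t) (hn : n = D.p.1 * t + D.p.2 + D.ε * j + k * M) :
    (hD.family hM).Occurs v (D.c, (n : ZMod M)) := by
  rw [← ZMod.intCast_eq_of_eq_add_mul k hn]
  simpa [h, zigzag] using hD.occurs_h hM v (i := 2 * j) (by omega)

theorem occurs_h_odd (j : ℕ) (hj : j < t) (hn : n = D.q.1 * t + D.q.2 - D.ε * j + k * M) :
    (hD.family hM).Occurs v (D.c, (n : ZMod M)) := by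
  have e : (2 * j + 1) / 2 = j := by omega
  rw [← ZMod.intCast_eq_of_eq_add_mul k hn]
  simpa [h, zigzag, e] using hD.occurs_h hM v (i := 2 * j + 1) (by omega)

theorem occurs_of_neg {c : ZMod 3} (h : ∀ w, (hD.family hM).Occurs w (c, ((-n : ℤ) : ZMod M))) :
    (hD.family hM).Occurs v (-c, (n : ZMod M)) := by
  simpa using hD.occurs_reverse hM (h (v - c))

theorem occurs_f_even (j : ℕ) (hj : j ≤ t) (hn : n = D.p'.1 * t + D.p'.2 - D.ε * j + k * M) :
    (hD.family hM).Occurs v (D.c', (n : ZMod M)) := by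
  rw [← ZMod.intCast_eq_of_eq_add_mul k hn]
  simpa [f, zigzag, sub_eq_add_neg] using hD.occurs_f hM v (i := 2 * j) (by omega)

theorem occurs_f_odd (j : ℕ) (hj : j < t) (hn : n = (D.p.1 + D.p'.1 - D.q.1) * t +
    (D.p.2 + D.p'.2 - D.q.2) + D.ε * j + k * M) :
    (hD.family hM).Occurs v (D.c', (n : ZMod M)) := by
  have e : (2 * j + 1) / 2 = j := by omega
  rw [← ZMod.intCast_eq_of_eq_add_mul k hn]
  simpa [f, zigzag, e] using hD.occurs_f hM v (i := 2 * j + 1) (by omega)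

theorem occurs_of_rung (i : ℕ) (hi : i < 2 * t)
    (hn : n = (D.p.1 - D.q.1) * t + (D.p.2 - D.q.2) + D.ε * i ∨
      n = -((D.p.1 - D.q.1) * t + (D.p.2 - D.q.2) + D.ε * i)) :
    (hD.family hM).Occurs v (0, (n : ZMod M)) := by
  -- Up to a sign that alternates with `i`, the rungs are `p - q + ε i`; with both signs present
  -- they sweep an interval of length `2 * t`.
  have h : (D.rung t M i = (0, (n : ZMod M))) ∨ -D.rung t M i = (0, (n : ZMod M)) := by
    obtain ⟨j, rfl | rfl⟩ := i.even_or_odd' <;> obtain rfl | rfl := hn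
    · right
      simp [rung, h, zigzag, show (2 * j + 1) / 2 = j by omega]
      ring
    · left
      simp [rung, h, zigzag, show (2 * j + 1) / 2 = j by omega]
      ring
    · left
      simp [rung, h, zigzag, show (2 * j + 1) / 2 = j by omega, show (2 * j + 1 + 1) / 2 = j + 1 by
        omega, Nat.even_add_one]
      ring
    · right
      simp [rung, h, zigzag, show (2 * j + 1) / 2 = j by omega, show (2 * j + 1 + 1) / 2 = j + 1 by
        omega, Nat.even_add_one]
      ring
  obtain h | h := h <;> rw [← h]
  exacts [hD.occurs_rung hM v hi, hD.occurs_neg_rung hM v hi]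

theorem isConnecting {v₀ : ZMod 3} {α β : ℤ} (hu : IsUnit ((α * t + β : ℤ) : ZMod M))
    (h0 : (v₀, 0, α, β) ∈ D.arcs) (h : ∀ w, ∃ x ∈ D.arcs, x.1 = w ∧ x.2.1 = v₀ - w) :
    (hD.family hM).IsConnecting := by
  refine ⟨v₀, _, hD.occurs_arc hM h0, hu, fun w => ?_⟩
  obtain ⟨x, hx, rfl, h⟩ := h w
  rw [← h]
  exact ⟨_, hD.occurs_arc hM hx⟩

end Valid

end LadderData

/-! ### The two families cover all arcs -/

theorem ladderData₁_arcs (v : ZMod 3) : ∀ x ∈ ([(1, 0, 0), (1, 0, 1), (1, 2, 4), (1, 2, 5),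
    (1, 4, 8), (1, 6, 10), (1, 6, 11), (0, 0, 1), (0, 2, 3)] : List FormalArc),
    (v, x) ∈ ladderData₁.arcs := by
  revert v; decide +kernel

theorem ladderData₂_arcs (v : ZMod 3) : ∀ x ∈ ([(1, 0, 2), (1, 4, 7), (1, 4, 9), (1, 0, -1),
    (0, 0, 2), (0, 4, 4), (0, 4, 5), (0, 4, 6), (0, 4, 7)] : List FormalArc),
    (v, x) ∈ ladderData₂.arcs := by
  revert v; decide +kernel

theorem ladderData₁_arcs_to_zero :
    ∀ w, ∃ x ∈ ladderData₁.arcs, x.1 = w ∧ x.2.1 = 0 - w := by decide +kernel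

theorem ladderData₂_arcs_to_zero :
    ∀ w, ∃ x ∈ ladderData₂.arcs, x.1 = w ∧ x.2.1 = 0 - w := by decide +kernel

theorem smallData_arcs (v : ZMod 3) (γ : ZMod 3 × ZMod 7) (hγ : γ ≠ 0) :
    (∃ x ∈ smallData₁.arcs, x.1 = v ∧ LadderData.eval 0 7 x.2 = γ) ∨
      ∃ x ∈ smallData₂.arcs, x.1 = v ∧ LadderData.eval 0 7 x.2 = γ := by
  revert v γ; decide +kernel

section Cover

variable {t M : ℕ} (hM : (M : ℤ) = 8 * t + 15)

theorem occurs_ladderData_one (v : ZMod 3) {n : ℤ} (h0 : 0 ≤ n) (hn : n < M) :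
    (ladderData₁_valid.family hM).Occurs v (1, (n : ZMod M)) ∨
      (ladderData₂_valid.family hM).Occurs v (1, (n : ZMod M)) := by
  have m₁ (α β : ℤ) (k : ℤ) (hx : (1, α, β) ∈ ([(1, 0, 0), (1, 0, 1), (1, 2, 4), (1, 2, 5),
      (1, 4, 8), (1, 6, 10), (1, 6, 11), (0, 0, 1), (0, 2, 3)] : List FormalArc))
      (h : n = α * t + β + k * M) :
      (ladderData₁_valid.family hM).Occurs v (1, (n : ZMod M)) :=
    ladderData₁_valid.occurs_of_mem_arcs hM k α β (ladderData₁_arcs v _ hx) h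
  have m₂ (α β : ℤ) (k : ℤ) (hx : (1, α, β) ∈ ([(1, 0, 2), (1, 4, 7), (1, 4, 9), (1, 0, -1),
      (0, 0, 2), (0, 4, 4), (0, 4, 5), (0, 4, 6), (0, 4, 7)] : List FormalArc))
      (h : n = α * t + β + k * M) :
      (ladderData₂_valid.family hM).Occurs v (1, (n : ZMod M)) :=
    ladderData₂_valid.occurs_of_mem_arcs hM k α β (ladderData₂_arcs v _ hx) h
  -- The even and odd halves of the four zigzags, those of the second graph's `h` side negated,
  -- sweep eight intervals; the eleven remaining residues come from listed triangles. The index in a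
  -- zigzag is the distance from the start of its interval.
  rcases lt_or_ge n 1 with h1 | h1
  · exact .inl (m₁ 0 0 0 (by decide) (by omega))
  rcases lt_or_ge n 2 with h2 | h2
  · exact .inl (m₁ 0 1 0 (by decide) (by omega))
  rcases lt_or_ge n 3 with h3 | h3
  · exact .inr (m₂ 0 2 0 (by decide) (by omega))
  rcases lt_or_ge n (t + 3) with h4 | h4
  · refine .inr (ladderData₂_valid.occurs_of_neg hM fun w =>
      ladderData₂_valid.occurs_h_odd hM (-1) (n - 3).toNat (by omega) ?_)
    simp only [ladderData₂]; omega
  rcases lt_or_ge n (2 * t + 4) with h5 | h5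
  · refine .inl (ladderData₁_valid.occurs_f_even hM 0 (n - (t + 3)).toNat (by omega) ?_)
    simp only [ladderData₁]; omega
  rcases lt_or_ge n (2 * t + 5) with h6 | h6
  · exact .inl (m₁ 2 4 0 (by decide) (by omega))
  rcases lt_or_ge n (2 * t + 6) with h7 | h7
  · exact .inl (m₁ 2 5 0 (by decide) (by omega))
  rcases lt_or_ge n (3 * t + 6) with h8 | h8
  · refine .inl (ladderData₁_valid.occurs_f_odd hM 0 (3 * t + 5 - n).toNat (by omega) ?_)
    simp only [ladderData₁]; omega
  rcases lt_or_ge n (4 * t + 7) with h9 | h9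
  · refine .inr (ladderData₂_valid.occurs_of_neg hM fun w =>
      ladderData₂_valid.occurs_h_even hM (-1) (4 * t + 6 - n).toNat (by omega) ?_)
    simp only [ladderData₂]; omega
  rcases lt_or_ge n (4 * t + 8) with h10 | h10
  · exact .inr (m₂ 4 7 0 (by decide) (by omega))
  rcases lt_or_ge n (4 * t + 9) with h11 | h11
  · exact .inl (m₁ 4 8 0 (by decide) (by omega))
  rcases lt_or_ge n (4 * t + 10) with h12 | h12
  · exact .inr (m₂ 4 9 0 (by decide) (by omega))
  rcases lt_or_ge n (5 * t + 10) with h13 | h13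
  · refine .inr (ladderData₂_valid.occurs_f_odd hM 0 (n - (4 * t + 10)).toNat (by omega) ?_)
    simp only [ladderData₂]; omega
  rcases lt_or_ge n (6 * t + 10) with h14 | h14
  · refine .inl (ladderData₁_valid.occurs_h_odd hM 0 (n - (5 * t + 10)).toNat (by omega) ?_)
    simp only [ladderData₁]; omega
  rcases lt_or_ge n (6 * t + 11) with h15 | h15
  · exact .inl (m₁ 6 10 0 (by decide) (by omega))
  rcases lt_or_ge n (6 * t + 12) with h16 | h16
  · exact .inl (m₁ 6 11 0 (by decide) (by omega))
  rcases lt_or_ge n (7 * t + 13) with h17 | h17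
  · refine .inl (ladderData₁_valid.occurs_h_even hM 0 (7 * t + 12 - n).toNat (by omega) ?_)
    simp only [ladderData₁]; omega
  rcases lt_or_ge n (8 * t + 14) with h18 | h18
  · refine .inr (ladderData₂_valid.occurs_f_even hM 0 (8 * t + 13 - n).toNat (by omega) ?_)
    simp only [ladderData₂]; omega
  · exact .inr (m₂ 0 (-1) 1 (by decide) (by omega))

theorem occurs_ladderData_zero (v : ZMod 3) {n : ℤ} (h0 : 0 < n) (hn : n ≤ 4 * t + 7) :
    (ladderData₁_valid.family hM).Occurs v (0, (n : ZMod M)) ∨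
      (ladderData₂_valid.family hM).Occurs v (0, (n : ZMod M)) := by
  have m₁ (α β : ℤ) (hx : (0, α, β) ∈ ([(1, 0, 0), (1, 0, 1), (1, 2, 4), (1, 2, 5),
      (1, 4, 8), (1, 6, 10), (1, 6, 11), (0, 0, 1), (0, 2, 3)] : List FormalArc))
      (h : n = α * t + β) :
      (ladderData₁_valid.family hM).Occurs v (0, (n : ZMod M)) :=
    ladderData₁_valid.occurs_of_mem_arcs hM 0 α β (ladderData₁_arcs v _ hx) (by omega)
  have m₂ (α β : ℤ) (hx : (0, α, β) ∈ ([(1, 0, 2), (1, 4, 7), (1, 4, 9), (1, 0, -1),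
      (0, 0, 2), (0, 4, 4), (0, 4, 5), (0, 4, 6), (0, 4, 7)] : List FormalArc))
      (h : n = α * t + β) :
      (ladderData₂_valid.family hM).Occurs v (0, (n : ZMod M)) :=
    ladderData₂_valid.occurs_of_mem_arcs hM 0 α β (ladderData₂_arcs v _ hx) (by omega)
  -- Rungs of the first graph give `3, …, 2t + 2`, rungs of the second `2t + 4, …, 4t + 3`.
  rcases lt_or_ge n 2 with h1 | h1
  · exact .inl (m₁ 0 1 (by decide) (by omega))
  rcases lt_or_ge n 3 with h2 | h2
  · exact .inr (m₂ 0 2 (by decide) (by omega))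
  rcases lt_or_ge n (2 * t + 3) with h3 | h3
  · refine .inl (ladderData₁_valid.occurs_of_rung hM (2 * t + 2 - n).toNat (by omega) (.inl ?_))
    simp only [ladderData₁]; omega
  rcases lt_or_ge n (2 * t + 4) with h4 | h4
  · exact .inl (m₁ 2 3 (by decide) (by omega))
  rcases lt_or_ge n (4 * t + 4) with h5 | h5
  · refine .inr (ladderData₂_valid.occurs_of_rung hM (4 * t + 3 - n).toNat (by omega) (.inr ?_))
    simp only [ladderData₂]; omega
  rcases lt_or_ge n (4 * t + 5) with h6 | h6
  · exact .inr (m₂ 4 4 (by decide) (by omega))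
  rcases lt_or_ge n (4 * t + 6) with h7 | h7
  · exact .inr (m₂ 4 5 (by decide) (by omega))
  rcases lt_or_ge n (4 * t + 7) with h8 | h8
  · exact .inr (m₂ 4 6 (by decide) (by omega))
  · exact .inr (m₂ 4 7 (by decide) (by omega))

theorem occurs_ladderData (v : ZMod 3) {γ : ZMod 3 × ZMod M} (hγ : γ ≠ 0) :
    (ladderData₁_valid.family hM).Occurs v γ ∨ (ladderData₂_valid.family hM).Occurs v γ := by
  have : NeZero M := ⟨by omega⟩
  have lift (z : ZMod M) : ∃ n : ℤ, 0 ≤ n ∧ n < M ∧ (n : ZMod M) = z :=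
    ⟨z.val, by positivity, by exact_mod_cast z.val_lt, by simp⟩
  have rev (h : (ladderData₁_valid.family hM).Occurs (v + γ.1) (-γ) ∨
      (ladderData₂_valid.family hM).Occurs (v + γ.1) (-γ)) :
      (ladderData₁_valid.family hM).Occurs v γ ∨ (ladderData₂_valid.family hM).Occurs v γ := by
    refine h.imp (fun h => ?_) fun h => ?_
    · simpa using ladderData₁_valid.occurs_reverse hM h
    · simpa using ladderData₂_valid.occurs_reverse hM h
  obtain ⟨c, z⟩ := γ
  obtain rfl | rfl | rfl := (by decide : ∀ c : ZMod 3, c = 0 ∨ c = 1 ∨ c = 2) c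
  · obtain ⟨n, h0, hn, rfl⟩ := lift z
    have hn0 : n ≠ 0 := by rintro rfl; simp at hγ
    -- `4t + 7 = (M - 1) / 2`, so reversal covers the other half of class 0; likewise class 2 is the
    -- reverse of class 1.
    rcases le_or_gt n (4 * t + 7) with h | h
    · exact occurs_ladderData_zero hM v (by omega) h
    · refine rev ?_
      have e : (-((0, (n : ZMod M)) : ZMod 3 × ZMod M)) = (0, ((M - n : ℤ) : ZMod M)) := by simp
      rw [e]
      exact occurs_ladderData_zero hM _ (by omega) (by omega)
  · obtain ⟨n, h0, hn, rfl⟩ := lift z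
    exact occurs_ladderData_one hM v h0 hn
  · refine rev ?_
    obtain ⟨n, h0, hn, h⟩ := lift (-z)
    have e : (-((2, z) : ZMod 3 × ZMod M)) = (1, (n : ZMod M)) := by rw [h]; rfl
    rw [e]
    exact occurs_ladderData_one hM _ h0 hn

end Cover

/-! ### Conclusion -/

theorem hasTriangularBiembedding_of_pos (t : ℕ) : HasTriangularBiembedding
    (⊤ : SimpleGraph (Fin (3 * (8 * t + 15)))) (24 * (t + 1) ^ 2 + 29 * (t + 1) + 8) := by
  have hM : ((8 * t + 15 : ℕ) : ℤ) = 8 * t + 15 := by push_cast; rfl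
  have h2 : IsUnit ((2 : ℕ) : ZMod (8 * t + 15)) :=
    (ZMod.isUnit_iff_coprime _ _).2 (Nat.coprime_two_left.2 ⟨4 * t + 7, by ring⟩)
  -- Each family has two triangles for each of `2t` rungs and three classes, and 22 listed ones.
  -- Connectedness uses the differences 1 and 2, the latter a unit because the modulus is odd.
  refine hasTriangularBiembedding_of_triangleFamily (k := 12 * t + 22)
    (ladderData₁_valid.family hM) (ladderData₂_valid.family hM) ?_ ?_ (by ring) (by ring)
    (fun v γ h => occurs_ladderData hM v h) (ladderData₁_valid.isRotational hM)
    (ladderData₂_valid.isRotational hM)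
    (ladderData₁_valid.isConnecting hM (α := 0) (β := 1) (by simp)
      (ladderData₁_arcs 0 _ (by decide)) ladderData₁_arcs_to_zero)
    (ladderData₂_valid.isConnecting hM (α := 0) (β := 2) (by simpa using h2)
      (ladderData₂_arcs 0 _ (by decide)) ladderData₂_arcs_to_zero)
  · simp [ladderData₁]; ring
  · simp [ladderData₂]; ring

theorem hasTriangularBiembedding_twentyOne :
    HasTriangularBiembedding (⊤ : SimpleGraph (Fin (3 * 7))) 8 := by
  have hM₁ : ((7 : ℕ) : ℤ) = smallData₁.A * (0 : ℕ) + smallData₁.m := rfl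
  have hM₂ : ((7 : ℕ) : ℤ) = smallData₂.A * (0 : ℕ) + smallData₂.m := rfl
  refine hasTriangularBiembedding_of_triangleFamily (k := 10)
    (smallData₁_valid.family hM₁) (smallData₂_valid.family hM₂) ?_ ?_ (by norm_num) (by norm_num)
    (fun v γ h => ?_) (smallData₁_valid.isRotational hM₁)
    (smallData₂_valid.isRotational hM₂)
    (smallData₁_valid.isConnecting hM₁ (v₀ := 2) (α := 0) (β := 1) (by simp)
      (by decide +kernel) (by decide +kernel))
    (smallData₂_valid.isConnecting hM₂ (v₀ := 0) (α := 0) (β := 2) (by decide +kernel)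
      (by decide +kernel) (by decide +kernel))
  · simp [smallData₁]
  · simp [smallData₂]
  · refine (smallData_arcs v γ h).imp ?_ ?_
    · rintro ⟨x, hx, rfl, rfl⟩
      exact smallData₁_valid.occurs_arc hM₁ hx
    · rintro ⟨x, hx, rfl, rfl⟩
      exact smallData₂_valid.occurs_arc hM₂ hx

theorem hasTriangularBiembedding_complete (s : ℕ) : HasTriangularBiembedding
    (⊤ : SimpleGraph (Fin (24 * s + 21))) (24 * s ^ 2 + 29 * s + 8) := by
  obtain _ | t := s
  · exact hasTriangularBiembedding_twentyOne
  · have e : 24 * (t + 1) + 21 = 3 * (8 * t + 15) := by ring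
    rw [e]
    exact hasTriangularBiembedding_of_pos t

theorem mainTheorem1 (s : ℕ) :
    HasTriangularBiembedding (⊤ : SimpleGraph (Fin (24 * s + 21))) (24 * s ^ 2 + 29 * s + 8) ∧
    bigenus (⊤ : SimpleGraph (Fin (24 * s + 21))) = 24 * s ^ 2 + 29 * s + 8 ∧
    (bigenus (⊤ : SimpleGraph (Fin (24 * s + 21))) : ℤ) =
      ⌈(((24 * s + 21 : ℕ) : ℚ) ^ 2 - 13 * ((24 * s + 21 : ℕ) : ℚ) + 24) / 24⌉ ∧
    bichromaticNumber (24 * s ^ 2 + 29 * s + 8) = 24 * s + 21 ∧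
    (bichromaticNumber (24 * s ^ 2 + 29 * s + 8) : ℤ) =
      ⌊(13 + Real.sqrt (73 + 96 * ((24 * s ^ 2 + 29 * s + 8 : ℕ) : ℝ))) / 2⌋ :=
  ⟨hasTriangularBiembedding_complete s,
    main_of_hasTriangularBiembedding s (hasTriangularBiembedding_complete s)⟩
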